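/- Consider an open network of $J$ infinite server queues, started empty. Batches arrive at the points $0<T_1<T_2<\cdots$ of a homogeneous Poisson process of rate $\lambda>0$. The $i$-th batch brings $\Sigma_{ij}$ customers to queue $j$, $1\le j\le J$; the vectors $(\Sigma_{i1},\dots,\Sigma_{iJ})\in\mathbb Z_{\ge 0}^J$ are i.i.d. with the law of a random vector $\mathbf S=(S_1,\dots,S_J)$. The $\ell$-th customer of batch $i$ entering at queue $j$ carries a stochastic process $X^j_{i,\ell}(t)$, $t\ge 0$, with right-continuous paths, whose value is the queue in which the customer is at time $T_i+t$, or a symbol for "outside the network"; $P(X^j_{i,\ell}(t)=k)=q^j_k(t)$ for all $i,\ell,k,t$. The Poisson process, the batch vectors and the processes $X^j_{i,\ell}$ are mutually independent. Let $$N_k(t)=\sum_{i:\,T_i\le t}\ \sum_{j=1}^J\ \sum_{\ell=1}^{\Sigma_{ij}}\mathbf 1\{X^j_{i,\ell}(t-T_i)=k\},\qquad Q_j(t)=\sum_{k=1}^J q^j_k(t),$$ so that $\mathbf N(t)=(N_1(t),\dots,N_J(t))$ is the vector of queue lengths at time $t$ and $Q_j(t)$ is the probability that a customer who entered at queue $j$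 is in the network at time $t$ after its arrival. Call the network ergodic if there is a probability distribution $\pi$ on $\mathbb Z_{\ge 0}^J$ with $\lim_{t\to\infty}P(\mathbf N(t)=\mathbf n)=\pi(\mathbf n)$ for every $\mathbf n\in\mathbb Z_{\ge 0}^J$. Suppose that for each $j\in\{1,\dots,J\}$ there exists $\delta_j>0$ such that $Q_j(\tau)=\Theta(e^{-\delta_j\tau})$ as $\tau\to\infty$. Then the network is ergodic if and only if $\mathbb E[\log(S_1+\dots+S_J+1)]<\infty$. -/

import Mathlib

open MeasureTheory ProbabilityTheory Filter Topology Asymptotics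
open scoped NNReal ENNReal

/-- The gaps between consecutive points of an increasing sequence of points started at time `0`:
the time of the first point, then the successive differences. -/
def interarrival {Ω : Type*} (T : ℕ → Ω → ℝ) : ℕ → Ω → ℝ
  | 0 => T 0
  | i + 1 => fun ω => T (i + 1) ω - T i ω

/-- The mutually independent sources of randomness of the network: for each arrival epoch, the gap
before it; for each arrival epoch, the batch size vector; for each customer, labelled by
(batch, entry queue, number in that part of the batch), its itinerary. -/
inductive Source (J : ℕ) : Type
  | gap (i : ℕ)
  | batch (i : ℕ)
  | customer (i : ℕ) (j : Fin J) (l : ℕ)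

/-- The sigma-algebra generated by one source of randomness. For a customer it is generated by the
whole process `t ↦ X i j l t` (the finite set `Option (Fin J)` being discrete). -/
abbrev sourceAlgebra {J : ℕ} {Ω : Type*} (T : ℕ → Ω → ℝ) (B : ℕ → Ω → Fin J → ℕ)
    (X : ℕ → Fin J → ℕ → ℝ≥0 → Ω → Option (Fin J)) : Source J → MeasurableSpace Ω
  | .gap i => MeasurableSpace.comap (interarrival T i) inferInstance
  | .batch i => MeasurableSpace.comap (B i) inferInstance
  | .customer i j l => ⨆ t : ℝ≥0, MeasurableSpace.comap (X i j l t) ⊤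

/-- An open network of `J` infinite server queues with multivariate batches that arrive at the
points of a homogeneous Poisson process. Batches and customers are numbered from `0`. -/
structure BatchNetwork (J : ℕ) {Ω : Type*} [MeasurableSpace Ω] (P : Measure Ω) where
  /-- The arrival rate of batches. -/
  rate : ℝ
  rate_pos : 0 < rate
  /-- The law of the batch size vector `S = (S_1, …, S_J)`. -/
  batchLaw : Measure (Fin J → ℕ)
  /-- `q j k t` is the probability that a customer who entered at queue `j` is in queue `k` at
  time `t` after its arrival. -/
  q : Fin J → Fin J → ℝ≥0 → ℝ
  /-- The arrival time of the `i`-th batch. -/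
  T : ℕ → Ω → ℝ
  /-- `B i ω j` is the number of customers of the `i`-th batch that arrive at queue `j`. -/
  B : ℕ → Ω → Fin J → ℕ
  /-- `X i j l t` is the queue in which the `l`-th customer of the `i`-th batch entering at queue
  `j` is found at time `t` after its arrival; `none` means outside of the network. Only the
  customers with `l < B i ω j` are actually there. -/
  X : ℕ → Fin J → ℕ → ℝ≥0 → Ω → Option (Fin J)
  measurable_T : ∀ i, Measurable (T i)
  measurable_B : ∀ i, Measurable (B i)
  measurable_X : ∀ i j l t, Measurable[_, ⊤] (X i j l t)
  /-- A customer stays for a positive time wherever it goes: itineraries are right-continuous. -/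
  rightCont_X : ∀ i j l ω t, ∀ᶠ u in 𝓝[≥] t, X i j l u ω = X i j l t ω
  /-- The gaps are exponential with the given rate (they are independent by `indep`), so that the
  `T i` are the successive points of a Poisson process on `[0, ∞)`. -/
  law_gap : ∀ i, HasLaw (interarrival T i) (expMeasure rate) P
  law_B : ∀ i, HasLaw (B i) batchLaw P
  law_X : ∀ i j l t k, P.real {ω | X i j l t ω = some k} = q j k t
  indep : iIndep (sourceAlgebra T B X) P

namespace BatchNetwork

variable {J : ℕ} {Ω : Type*} [MeasurableSpace Ω] {P : Measure Ω}

/-- The probability that a customer who entered at queue `j` is anywhere in the network at time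
`t` after its arrival. -/
noncomputable def Q (net : BatchNetwork J P) (j : Fin J) (t : ℝ≥0) : ℝ :=
  ∑ k, net.q j k t

/-- The number of customers of the `i`-th batch in queue `k` at time `s` after its arrival. -/
def C (net : BatchNetwork J P) (i : ℕ) (k : Fin J) (s : ℝ≥0) (ω : Ω) : ℕ :=
  ∑ j, ((Finset.range (net.B i ω j)).filter fun l => net.X i j l s ω = some k).card

/-- The number of customers in queue `k` at time `t`, the network being empty before time `0`.
It is finite almost surely. -/
noncomputable def N (net : BatchNetwork J P) (k : Fin J) (t : ℝ≥0) (ω : Ω) : ℕ∞ :=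
  ∑' i, if net.T i ω ≤ t then (net.C i k (t - net.T i ω).toNNReal ω : ℕ∞) else 0

/-- Ergodicity: the vector of queue lengths converges in distribution, as time tends to infinity,
to a proper (probability) distribution on `ℕ^J`. -/
def IsErgodic (net : BatchNetwork J P) : Prop :=
  ∃ π : PMF (Fin J → ℕ), ∀ n : Fin J → ℕ,
    Tendsto (fun t : ℝ≥0 => P {ω | ∀ k, net.N k t ω = n k}) atTop (𝓝 (π n))

end BatchNetwork

/-- Of two independent random elements, one may be frozen in the integral of a function of both. -/
lemma lintegral_indepFun_eq_lintegral_lintegral {Ω A B : Type*} [MeasurableSpace Ω]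
    [MeasurableSpace A] [MeasurableSpace B] {P : Measure Ω} [IsProbabilityMeasure P] {U : Ω → A}
    {V : Ω → B} (hU : Measurable U) (hV : Measurable V) (h : IndepFun U V P) {ψ : A → B → ℝ≥0∞}
    (hψ : Measurable fun p : A × B => ψ p.1 p.2) :
    ∫⁻ ω, ψ (U ω) (V ω) ∂P = ∫⁻ ω, ∫⁻ ω', ψ (U ω) (V ω') ∂P ∂P := by
  have := Measure.isProbabilityMeasure_map (μ := P) hV.aemeasurable
  have := Measure.isProbabilityMeasure_map (μ := P) hU.aemeasurable
  rw [← lintegral_map (f := fun p : A × B => ψ p.1 p.2) (g := fun ω => (U ω, V ω)) hψ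
    (hU.prodMk hV), h.map_prod_eq_prod_map_map hU.aemeasurable hV.aemeasurable,
    lintegral_prod _ hψ.aemeasurable, lintegral_map hψ.lintegral_prod_right' hU]
  refine lintegral_congr fun ω => ?_
  rw [lintegral_map (f := fun b => ψ (U ω) b) (hψ.comp measurable_prodMk_left) hV]

/-- If `U` is independent of a sigma-algebra `m₂`, then `U` may be frozen in the integral of a
function of `U` and of an `m₂`-measurable quantity. -/
lemma lintegral_freeze_of_indep {Ω A : Type*} [mΩ : MeasurableSpace Ω] [MeasurableSpace A]
    {P : Measure Ω} [IsProbabilityMeasure P] {U : Ω → A} (hU : Measurable U)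
    {m₂ : MeasurableSpace Ω} (hm₂ : m₂ ≤ mΩ)
    (h : Indep (MeasurableSpace.comap U inferInstance) m₂ P) {φ : A → Ω → ℝ≥0∞}
    (hφ : Measurable[Prod.instMeasurableSpace (m₂ := m₂)] fun p : A × Ω => φ p.1 p.2) :
    ∫⁻ ω, φ (U ω) ω ∂P = ∫⁻ ω, ∫⁻ ω', φ (U ω) ω' ∂P ∂P := by
  refine @lintegral_indepFun_eq_lintegral_lintegral Ω A Ω mΩ _ m₂ P _ U id hU
    (measurable_id'' hm₂) ?_ φ hφ
  rw [IndepFun_iff_Indep, MeasurableSpace.comap_id]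
  exact h

/-- A right-continuous process with values in a countable discrete space is jointly measurable. -/
lemma measurable_uncurry_of_eventually_eq_right {Ω D : Type*} {m : MeasurableSpace Ω} [Countable D]
    {X : ℝ≥0 → Ω → D} (hX : ∀ t, Measurable[m, ⊤] (X t))
    (hrc : ∀ ω t, ∀ᶠ u in 𝓝[≥] t, X u ω = X t ω) :
    Measurable[_, ⊤] fun p : ℝ≥0 × Ω => X p.1 p.2 := by
  let _ : MeasurableSpace D := ⊤
  obtain ⟨c, hc⟩ : ∃ c : ℕ → ℕ → ℝ≥0, ∀ s : ℝ≥0,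
      Tendsto (fun n => c n ⌊((n : ℝ≥0) + 1) * s⌋₊) atTop (𝓝[≥] s) := by
    refine ⟨fun n k => ((k : ℝ≥0) + 1) / ((n : ℝ≥0) + 1), fun s => ?_⟩
    have hge : ∀ n : ℕ, s ≤ ((⌊((n : ℝ≥0) + 1) * s⌋₊ : ℝ≥0) + 1) / ((n : ℝ≥0) + 1) := fun n => by
      rw [le_div_iff₀ (by positivity), mul_comm]
      exact (Nat.lt_floor_add_one _).le
    have hle : ∀ n : ℕ, ((⌊((n : ℝ≥0) + 1) * s⌋₊ : ℝ≥0) + 1) / ((n : ℝ≥0) + 1)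
        ≤ s + 1 / ((n : ℝ≥0) + 1) := fun n => by
      have : (0 : ℝ≥0) < (n : ℝ≥0) + 1 := by positivity
      rw [div_le_iff₀ this, add_mul s, div_mul_cancel₀ _ this.ne', mul_comm s]
      gcongr
      exact Nat.floor_le (by positivity)
    refine tendsto_nhdsWithin_iff.2 ⟨?_, Eventually.of_forall hge⟩
    refine tendsto_of_tendsto_of_tendsto_of_le_of_le tendsto_const_nhds ?_ hge hle
    simpa using tendsto_const_nhds.add (tendsto_one_div_add_atTop_nhds_zero_nat (𝕜 := ℝ≥0))
  have hmeas : ∀ n : ℕ, Measurable fun p : ℝ≥0 × Ω => X (c n ⌊((n : ℝ≥0) + 1) * p.1⌋₊) p.2 := by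
    intro n
    have h1 : Measurable fun p : ℕ × Ω => X (c n p.1) p.2 :=
      measurable_from_prod_countable_right fun k => hX (c n k)
    have h2 : Measurable fun p : ℝ≥0 × Ω => (⌊((n : ℝ≥0) + 1) * p.1⌋₊, p.2) :=
      (Nat.measurable_floor.comp (measurable_fst.const_mul _)).prodMk measurable_snd
    exact h1.comp h2
  refine measurable_to_countable' fun x => ?_
  have : (fun p : ℝ≥0 × Ω => X p.1 p.2) ⁻¹' {x} =
      {p | ∃ a, ∀ n, a ≤ n → X (c n ⌊((n : ℝ≥0) + 1) * p.1⌋₊) p.2 = x} := by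
    ext p
    have hp : ∀ᶠ n in atTop, X (c n ⌊((n : ℝ≥0) + 1) * p.1⌋₊) p.2 = X p.1 p.2 := (hc p.1).eventually (hrc p.2 p.1)
    simp only [Set.mem_preimage, Set.mem_singleton_iff, Set.mem_ofPred_eq, ← eventually_atTop]
    constructor
    · intro h
      filter_upwards [hp] with n hn
      rw [hn, h]
    · intro h
      obtain ⟨n, h1, h2⟩ := (h.and hp).exists
      rw [← h2, h1]
  rw [this]
  simp only [Set.ofPred_exists, Set.ofPred_forall]
  exact .iUnion fun a => .iInter fun n => .iInter fun _ => hmeas n (measurableSet_singleton x)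

/-- `renewalIter μ h n t` is the expectation of `∏ i < n, h (t - T i)` when the points `T i` have
independent gaps with law `μ`, defined by conditioning on the first gap. -/
noncomputable def renewalIter (μ : Measure ℝ) (h : ℝ → ℝ≥0∞) : ℕ → ℝ → ℝ≥0∞
  | 0 => fun _ => 1
  | n + 1 => fun t => ∫⁻ x, h (t - x) * renewalIter μ h n (t - x) ∂μ

lemma measurable_mul_prod_sub_partialSums {Ω : Type*} [MeasurableSpace Ω] {Y : ℕ → Ω → ℝ}
    (hY : ∀ i, Measurable (Y i)) {h : ℝ → ℝ≥0∞} (hh : Measurable h) (n : ℕ) (t : ℝ) :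
    Measurable fun p : ℝ × Ω => h (t - p.1) * ∏ i ∈ Finset.range n,
      h (t - p.1 - ∑ l ∈ Finset.range (i + 1), Y l p.2) := by
  refine Measurable.mul (by fun_prop) (Finset.measurable_prod _ fun i _ => hh.comp ?_)
  exact (measurable_const.sub measurable_fst).sub
    (Finset.measurable_sum _ fun l _ => (hY l).comp measurable_snd)

/-- The sigma-algebra generated by the members of a sequence that come after the `m`-th. -/
abbrev laterAlgebra {Ω : Type*} (Y : ℕ → Ω → ℝ) (m : ℕ) : MeasurableSpace Ω :=
  ⨆ l ∈ Set.Ioi m, MeasurableSpace.comap (Y l) inferInstance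

lemma lintegral_prod_partialSums_eq_renewalIter {Ω : Type*} [mΩ : MeasurableSpace Ω]
    {P : Measure Ω} [IsProbabilityMeasure P] {Y : ℕ → Ω → ℝ} (hY : ∀ i, Measurable (Y i))
    (hindep : iIndepFun Y P) {μ : Measure ℝ} (hlaw : ∀ i, P.map (Y i) = μ)
    {h : ℝ → ℝ≥0∞} (hh : Measurable h) (n : ℕ) : Measurable (renewalIter μ h n) ∧
    ∀ (m : ℕ) (t : ℝ), ∫⁻ ω, ∏ i ∈ Finset.range n, h (t - ∑ l ∈ Finset.range (i + 1), Y (m + l) ω) ∂P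
      = renewalIter μ h n t := by
  have hμ : IsProbabilityMeasure μ := hlaw 0 ▸ Measure.isProbabilityMeasure_map (hY 0).aemeasurable
  induction n with
  | zero => exact ⟨measurable_const, fun m t => by simp [renewalIter]⟩
  | succ n ih =>
    obtain ⟨hm, ih⟩ := ih
    have hmeas : Measurable fun p : ℝ × ℝ => h (p.1 - p.2) * renewalIter μ h n (p.1 - p.2) :=
      (hh.comp (measurable_fst.sub measurable_snd)).mul
        (hm.comp (measurable_fst.sub measurable_snd))
    refine ⟨hmeas.lintegral_prod_right', fun m t => ?_⟩
    have hm₂ : laterAlgebra Y m ≤ mΩ := iSup₂_le fun l _ => (hY l).comap_le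
    have hind : Indep (MeasurableSpace.comap (Y m) inferInstance) (laterAlgebra Y m) P := by
      have := indep_iSup_of_disjoint (fun l => (hY l).comap_le) hindep.iIndep
        (S := {m}) (T := Set.Ioi m) (by simp)
      rw [iSup_singleton] at this
      exact this
    let φ : ℝ → Ω → ℝ≥0∞ := fun y ω => h (t - y) * ∏ i ∈ Finset.range n,
      h (t - y - ∑ l ∈ Finset.range (i + 1), Y (m + 1 + l) ω)
    have hYm : ∀ l, Measurable[laterAlgebra Y m] (Y (m + 1 + l)) := fun l =>
      (comap_measurable (Y (m + 1 + l))).mono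
        (le_iSup₂_of_le (m + 1 + l) (by simp; omega) le_rfl) le_rfl
    have hφ : Measurable[Prod.instMeasurableSpace (m₂ := laterAlgebra Y m)]
        fun p : ℝ × Ω => φ p.1 p.2 :=
      @measurable_mul_prod_sub_partialSums Ω (laterAlgebra Y m) _ hYm h hh n t
    have hfreeze := lintegral_freeze_of_indep (hY m) hm₂ hind hφ
    calc _ = ∫⁻ ω, φ (Y m ω) ω ∂P := by
          refine lintegral_congr fun ω => ?_
          rw [Finset.prod_range_succ', mul_comm]
          simp only [φ]
          congr 1
          · simp
          · refine Finset.prod_congr rfl fun i _ => ?_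
            congr 1
            rw [Finset.sum_range_succ', sub_sub, add_comm (Y m ω)]
            simp [add_assoc, add_comm 1]
      _ = ∫⁻ ω, h (t - Y m ω) * renewalIter μ h n (t - Y m ω) ∂P := by
          rw [hfreeze]
          refine lintegral_congr fun ω => ?_
          simp only [φ]
          rw [lintegral_const_mul, ih]
          exact Finset.measurable_prod _ fun i _ => hh.comp (measurable_const.sub
            (Finset.measurable_sum _ fun l _ => hY _))
      _ = _ := by
          have hmt : Measurable fun x => h (t - x) * renewalIter μ h n (t - x) :=
            hmeas.comp (measurable_prodMk_left (x := t))
          rw [← lintegral_map (f := fun x => h (t - x) * renewalIter μ h n (t - x)) hmt (hY m),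
            hlaw m]
          rfl

lemma renewalIter_le_one {μ : Measure ℝ} [IsProbabilityMeasure μ] {h : ℝ → ℝ≥0∞}
    (hh : ∀ s, h s ≤ 1) (n : ℕ) (t : ℝ) : renewalIter μ h n t ≤ 1 := by
  induction n generalizing t with
  | zero => exact le_rfl
  | succ n ih =>
    calc renewalIter μ h (n + 1) t ≤ ∫⁻ _, 1 ∂μ :=
          lintegral_mono fun x => mul_le_one' (hh _) (ih _)
      _ = 1 := by simp

lemma expMeasure_eq_withDensity (r : ℝ) :
    expMeasure r = volume.withDensity (exponentialPDF r) := rfl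

lemma measurable_exponentialPDF (r : ℝ) : Measurable (exponentialPDF r) :=
  (measurable_exponentialPDFReal r).ennreal_ofReal

lemma expMeasure_Iic {r : ℝ} (hr : 0 < r) {t : ℝ} (ht : 0 ≤ t) :
    expMeasure r (Set.Iic t) = ENNReal.ofReal (1 - Real.exp (-(r * t))) := by
  rw [expMeasure_eq_withDensity, withDensity_apply _ measurableSet_Iic,
    lintegral_exponentialPDF_eq_antiDeriv hr, if_pos ht]

lemma ae_expMeasure_nonneg (r : ℝ) : ∀ᵐ x ∂expMeasure r, 0 ≤ x := by
  rw [ae_iff, expMeasure_eq_withDensity]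
  simp only [not_le]
  change (volume.withDensity (exponentialPDF r)) (Set.Iio 0) = 0
  rw [withDensity_apply _ measurableSet_Iio, lintegral_exponentialPDF_of_nonpos le_rfl]

/-- The probability generating functional of a Poisson process of rate `r` on `[0, t]`, at `g`. -/
noncomputable def poissonFunctional (r : ℝ) (g : ℝ → ℝ) (t : ℝ) : ℝ :=
  Real.exp (-(r * ∫ s in (0 : ℝ)..t, (1 - g s)))

section

variable {r : ℝ} {g : ℝ → ℝ}

lemma intervalIntegrable_one_sub (hg : Measurable g) (hg0 : ∀ s, 0 ≤ g s) (hg1 : ∀ s, g s ≤ 1)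
    (a b : ℝ) : IntervalIntegrable (fun s => 1 - g s) volume a b := by
  refine (intervalIntegrable_const (c := (1 : ℝ))).mono_fun
    (measurable_const.sub hg).aestronglyMeasurable (Eventually.of_forall fun s => ?_)
  change ‖1 - g s‖ ≤ ‖(1 : ℝ)‖
  rw [Real.norm_of_nonneg (by linarith [hg1 s]), norm_one]
  linarith [hg0 s]

lemma poissonFunctional_of_neg (hgneg : ∀ s < 0, g s = 1) {t : ℝ} (ht : t ≤ 0) :
    poissonFunctional r g t = 1 := by
  have : ∫ s in (0 : ℝ)..t, (1 - g s) = 0 := by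
    rw [intervalIntegral.integral_symm, intervalIntegral.integral_of_le ht,
      integral_Ioc_eq_integral_Ioo, setIntegral_congr_fun (g := fun _ => 0) measurableSet_Ioo]
    · simp
    · intro s hs
      simp [hgneg s hs.2]
  simp [poissonFunctional, this]

lemma poissonFunctional_le_one (hr : 0 < r) (hg1 : ∀ s, g s ≤ 1) (hgneg : ∀ s < 0, g s = 1)
    (t : ℝ) : poissonFunctional r g t ≤ 1 := by
  rcases le_total t 0 with ht | ht
  · exact (poissonFunctional_of_neg hgneg ht).le
  · refine Real.exp_le_one_iff.2 (neg_nonpos.2 (mul_nonneg hr.le ?_))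
    exact intervalIntegral.integral_nonneg ht fun s _ => by linarith [hg1 s]

lemma continuous_poissonFunctional (hg : Measurable g) (hg0 : ∀ s, 0 ≤ g s)
    (hg1 : ∀ s, g s ≤ 1) : Continuous (poissonFunctional r g) := by
  have := intervalIntegral.continuous_primitive (intervalIntegrable_one_sub hg hg0 hg1) 0
  unfold poissonFunctional
  fun_prop

lemma measurable_poissonFunctional (hg : Measurable g) (hg0 : ∀ s, 0 ≤ g s)
    (hg1 : ∀ s, g s ≤ 1) : Measurable (poissonFunctional r g) :=
  (continuous_poissonFunctional hg hg0 hg1).measurable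

/-- The renewal equation at the first point of the Poisson process. -/
lemma lintegral_expMeasure_poissonFunctional (hr : 0 < r) (hg : Measurable g)
    (hg0 : ∀ s, 0 ≤ g s) (hg1 : ∀ s, g s ≤ 1) (hgneg : ∀ s < 0, g s = 1)
    (hrc : ∀ s, ContinuousWithinAt g (Set.Ioi s) s) (t : ℝ) :
    ∫⁻ x, ENNReal.ofReal (g (t - x)) * ENNReal.ofReal (poissonFunctional r g (t - x))
      ∂expMeasure r = ENNReal.ofReal (poissonFunctional r g t) := by
  set G := poissonFunctional r g with hG
  have hGc : Continuous G := continuous_poissonFunctional hg hg0 hg1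
  have hGpos : ∀ s, 0 ≤ G s := fun s => (Real.exp_pos _).le
  let ψ : ℝ → ℝ := fun s => r * Real.exp (-(r * (t - s))) * (g s * G s)
  have hψ0 : ∀ s, 0 ≤ ψ s := fun s => by have := hg0 s; have := hGpos s; positivity
  have hψm : Measurable ψ := by
    have := hGc.measurable
    fun_prop
  let Ψ : ℝ → ℝ := fun s => Real.exp (-(r * (t - s))) * G s
  have hΨc : Continuous Ψ := by fun_prop
  have hψle : ∀ s, ψ s ≤ r * Real.exp (-(r * (t - s))) := fun s => by
    have h1 : g s * G s ≤ 1 := mul_le_one₀ (hg1 s) (hGpos s)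
      (poissonFunctional_le_one hr hg1 hgneg s)
    have : 0 ≤ r * Real.exp (-(r * (t - s))) := by positivity
    exact mul_le_of_le_one_right this h1
  have hψi : ∀ a b, IntervalIntegrable ψ volume a b := fun a b => by
    have hc : Continuous fun s => r * Real.exp (-(r * (t - s))) := by fun_prop
    refine (hc.intervalIntegrable a b).mono_fun hψm.aestronglyMeasurable
      (Eventually.of_forall fun s => ?_)
    change ‖ψ s‖ ≤ _
    rw [Real.norm_of_nonneg (hψ0 s)]
    exact (hψle s).trans (le_abs_self _)
  have hderiv : ∀ s, HasDerivWithinAt Ψ (ψ s) (Set.Ioi s) s := by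
    intro s
    have h1 : HasDerivWithinAt (fun u => ∫ x in (0 : ℝ)..u, (1 - g x)) (1 - g s) (Set.Ici s) s :=
      intervalIntegral.integral_hasDerivWithinAt_right (t := Set.Ioi s)
        (intervalIntegrable_one_sub hg hg0 hg1 0 s)
        (measurable_const.sub hg).stronglyMeasurable.stronglyMeasurableAtFilter
        (continuousWithinAt_const.sub (hrc s))
    have h2 : HasDerivWithinAt G (G s * -(r * (1 - g s))) (Set.Ioi s) s :=
      ((h1.mono Set.Ioi_subset_Ici_self).const_mul r).neg.exp
    have h3 : HasDerivAt (fun u => Real.exp (-(r * (t - u)))) (Real.exp (-(r * (t - s))) * r) s := by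
      have : HasDerivAt (fun u => -(r * (t - u))) r s :=
        (((hasDerivAt_id s).const_sub t).const_mul r).neg.congr_deriv (by simp)
      exact this.exp
    refine (h3.hasDerivWithinAt.mul h2).congr_deriv ?_
    simp only [ψ]
    ring
  have hint : ∀ n : ℕ, ∫⁻ s in Set.Ioc (t - n) t, ENNReal.ofReal (ψ s)
      = ENNReal.ofReal (G t - Ψ (t - n)) := by
    intro n
    have hle : t - n ≤ t := by simp
    rw [← ofReal_integral_eq_lintegral_ofReal ((intervalIntegrable_iff_integrableOn_Ioc_of_le hle).1
      (hψi _ _)) (Eventually.of_forall hψ0), ← intervalIntegral.integral_of_le hle,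
      intervalIntegral.integral_eq_sub_of_hasDeriv_right_of_le hle hΨc.continuousOn
      (fun s _ => hderiv s) (hψi _ _)]
    simp [Ψ]
  have hlim1 : Tendsto (fun n : ℕ => ∫⁻ s in Set.Ioc (t - n) t, ENNReal.ofReal (ψ s)) atTop
      (𝓝 (∫⁻ s in Set.Iic t, ENNReal.ofReal (ψ s))) := by
    have hcov : AECover (volume.restrict (Set.Iic t)) atTop
        fun n : ℕ => Set.Ioc (t - (n : ℝ)) t := by
      have := (aecover_Ioi (μ := (volume : Measure ℝ).restrict (Set.Iic t))
        (a := fun n : ℕ => t - (n : ℝ)) (l := atTop)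
        (tendsto_atBot_add_const_left _ _ (tendsto_neg_atTop_atBot.comp tendsto_natCast_atTop_atTop)))
      refine ⟨?_, fun n => measurableSet_Ioc⟩
      filter_upwards [this.ae_eventually_mem, ae_restrict_mem measurableSet_Iic] with s hs hs'
      filter_upwards [hs] with n hn using ⟨hn, hs'⟩
    have := hcov.lintegral_tendsto_of_countably_generated (f := fun s => ENNReal.ofReal (ψ s))
      hψm.ennreal_ofReal.aemeasurable
    refine this.congr fun n => ?_
    rw [Measure.restrict_restrict measurableSet_Ioc]
    congr 2
    ext s
    simp only [Set.mem_inter_iff, Set.mem_Ioc, Set.mem_Iic]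
    tauto
  have hlim2 : Tendsto (fun n : ℕ => ENNReal.ofReal (G t - Ψ (t - n))) atTop
      (𝓝 (ENNReal.ofReal (G t))) := by
    refine ENNReal.tendsto_ofReal ?_
    have : Tendsto (fun n : ℕ => Ψ (t - n)) atTop (𝓝 0) := by
      have h1 : Tendsto (fun n : ℕ => Real.exp (-(r * (n : ℝ)))) atTop (𝓝 0) :=
        Real.tendsto_exp_neg_atTop_nhds_zero.comp
          (tendsto_natCast_atTop_atTop.const_mul_atTop hr)
      refine squeeze_zero (fun n => by have := hGpos (t - n); positivity) (fun n => ?_) h1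
      simp only [Ψ, sub_sub_cancel]
      exact mul_le_of_le_one_right (Real.exp_pos _).le
        (poissonFunctional_le_one hr hg1 hgneg _)
    simpa using tendsto_const_nhds.sub this
  have hIic : ∫⁻ s in Set.Iic t, ENNReal.ofReal (ψ s) = ENNReal.ofReal (G t) :=
    tendsto_nhds_unique hlim1 (hlim2.congr fun n => (hint n).symm)
  rw [expMeasure_eq_withDensity, lintegral_withDensity_eq_lintegral_mul _
    (measurable_exponentialPDF r) (by have := hGc.measurable; fun_prop), ← hIic,
    ← lintegral_indicator measurableSet_Iic, ← lintegral_sub_left_eq_self _ t]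
  refine lintegral_congr fun s => ?_
  simp only [Pi.mul_apply, exponentialPDF_eq, Set.indicator_apply, Set.mem_Iic, sub_sub_cancel,
    sub_nonneg]
  split_ifs with hs
  · rw [← ENNReal.ofReal_mul (hg0 _), ← ENNReal.ofReal_mul (by positivity)]
  · simp

/-- Expectations of products over the points of a Poisson process. -/
lemma tendsto_renewalIter_expMeasure (hr : 0 < r) (hg : Measurable g)
    (hg0 : ∀ s, 0 ≤ g s) (hg1 : ∀ s, g s ≤ 1) (hgneg : ∀ s < 0, g s = 1)
    (hrc : ∀ s, ContinuousWithinAt g (Set.Ioi s) s) {t : ℝ} (ht : 0 ≤ t) :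
    Tendsto (fun n => renewalIter (expMeasure r) (fun s => ENNReal.ofReal (g s)) n t) atTop
      (𝓝 (ENNReal.ofReal (poissonFunctional r g t))) := by
  have : IsProbabilityMeasure (expMeasure r) := isProbabilityMeasure_expMeasure hr
  set h : ℝ → ℝ≥0∞ := fun s => ENNReal.ofReal (g s) with hh
  have hh1 : ∀ s, h s ≤ 1 := fun s => by simpa [h] using hg1 s
  set G : ℝ → ℝ≥0∞ := fun s => ENNReal.ofReal (poissonFunctional r g s) with hG
  have hfix : ∀ s, ∫⁻ x, h (s - x) * G (s - x) ∂expMeasure r = G s :=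
    lintegral_expMeasure_poissonFunctional hr hg hg0 hg1 hgneg hrc
  have hGm : Measurable G := (measurable_poissonFunctional hg hg0 hg1).ennreal_ofReal
  have hlow : ∀ n s, G s ≤ renewalIter (expMeasure r) h n s := by
    intro n
    induction n with
    | zero =>
      intro s
      simpa [G, renewalIter] using poissonFunctional_le_one hr hg1 hgneg s
    | succ n ih =>
      intro s
      rw [← hfix s, renewalIter]
      exact lintegral_mono fun x => mul_le_mul_right (ih _) _
  set a : ℝ≥0∞ := expMeasure r (Set.Iic t) with ha
  have hup : ∀ n, ∀ s ≤ t, renewalIter (expMeasure r) h n s ≤ G s + a ^ n := by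
    intro n
    induction n with
    | zero => intro s _; simp [renewalIter]
    | succ n ih =>
      intro s hs
      calc renewalIter (expMeasure r) h (n + 1) s
          ≤ ∫⁻ x, (h (s - x) * G (s - x) + (Set.Iic t).indicator (fun _ => a ^ n) x)
              ∂expMeasure r := by
            refine lintegral_mono_ae ?_
            filter_upwards [ae_expMeasure_nonneg r] with x hx
            by_cases hxs : x ≤ t
            · rw [Set.indicator_of_mem (by exact hxs)]
              calc h (s - x) * renewalIter (expMeasure r) h n (s - x)
                  ≤ h (s - x) * (G (s - x) + a ^ n) := by gcongr; exact ih _ (by linarith)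
                _ ≤ h (s - x) * G (s - x) + 1 * a ^ n := by
                  rw [mul_add]; gcongr; exact hh1 _
                _ = _ := by rw [one_mul]
            · rw [Set.indicator_of_notMem (by exact hxs), add_zero]
              gcongr
              refine (renewalIter_le_one hh1 n _).trans_eq ?_
              simp [G, poissonFunctional_of_neg hgneg (t := s - x) (by linarith)]
        _ = G s + a ^ (n + 1) := by
            rw [lintegral_add_right _ (measurable_const.indicator measurableSet_Iic), hfix,
              lintegral_indicator measurableSet_Iic, setLIntegral_const, pow_succ]
  have ha1 : a < 1 := by
    rw [ha, expMeasure_Iic hr ht, ENNReal.ofReal_lt_one]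
    linarith [Real.exp_pos (-(r * t))]
  have hlim : Tendsto (fun n => G t + a ^ n) atTop (𝓝 (G t)) := by
    simpa using tendsto_const_nhds.add (ENNReal.tendsto_pow_atTop_nhds_zero_of_lt_one ha1)
  exact tendsto_of_tendsto_of_tendsto_of_le_of_le tendsto_const_nhds hlim
    (fun n => hlow n t) fun n => hup n t le_rfl

end

/-- The factor `z k` for a customer in queue `k`, and `1` for a customer outside of the network. -/
def customerWeight {J : ℕ} (z : Fin J → ℝ) : Option (Fin J) → ℝ
  | none => 1
  | some k => z k

lemma customerWeight_nonneg {J : ℕ} {z : Fin J → ℝ} (hz : ∀ k, 0 ≤ z k) (o : Option (Fin J)) :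
    0 ≤ customerWeight z o := by
  cases o with
  | none => exact zero_le_one
  | some k => exact hz k

lemma prod_pow_card_eq_prod_customerWeight {J : ℕ} (z : Fin J → ℝ) (b : Fin J → ℕ)
    (x : Fin J → ℕ → Option (Fin J)) :
    ∏ k, z k ^ (∑ j, ((Finset.range (b j)).filter fun l => x j l = some k).card)
      = ∏ j, ∏ l ∈ Finset.range (b j), customerWeight z (x j l) := by
  have h : ∀ o : Option (Fin J), ∏ k, (if o = some k then z k else 1) = customerWeight z o := by
    intro o
    cases o with
    | none => simp [customerWeight]
    | some k => simp [customerWeight]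
  simp_rw [← h, ← Finset.prod_pow_eq_pow_sum]
  rw [Finset.prod_comm]
  refine Finset.prod_congr rfl fun j _ => ?_
  rw [Finset.prod_comm]
  refine Finset.prod_congr rfl fun k _ => ?_
  rw [← Finset.prod_filter, Finset.prod_const]

lemma measurable_customerWeight {J : ℕ} {Ω : Type*} {m : MeasurableSpace Ω} (z : Fin J → ℝ)
    {X : Ω → Option (Fin J)} (hX : Measurable[m, ⊤] X) :
    Measurable fun ω => customerWeight z (X ω) :=
  (measurable_from_top (f := customerWeight z)).comp hX

@[to_additive]
lemma measurable_prod_range_prod {J : ℕ} {A M : Type*} [MeasurableSpace A] [MeasurableSpace M]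
    [CommMonoid M] [MeasurableMul₂ M] {f : Fin J → ℕ → A → M} (hf : ∀ j l, Measurable (f j l)) :
    Measurable fun p : (Fin J → ℕ) × A => ∏ j, ∏ l ∈ Finset.range (p.1 j), f j l p.2 :=
  measurable_from_prod_countable_right fun b =>
    Finset.measurable_prod Finset.univ fun j _ =>
      Finset.measurable_prod (Finset.range (b j)) fun l _ => hf j l

lemma measurable_prod_pow_count {J : ℕ} {Ω : Type*} [MeasurableSpace Ω] {B : Ω → Fin J → ℕ}
    {X : Fin J → ℕ → ℝ≥0 → Ω → Option (Fin J)} (hB : Measurable B)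
    (hX : ∀ j l t, Measurable[_, ⊤] (X j l t))
    (hrc : ∀ j l ω t, ∀ᶠ u in 𝓝[≥] t, X j l u ω = X j l t ω) (z : Fin J → ℝ) :
    Measurable fun p : ℝ≥0 × Ω => ∏ j, ∏ l ∈ Finset.range (B p.2 j),
      customerWeight z (X j l p.1 p.2) := by
  have h1 := measurable_prod_range_prod (f := fun j l (p : ℝ≥0 × Ω) =>
    customerWeight z (X j l p.1 p.2)) fun j l => measurable_customerWeight z
      (measurable_uncurry_of_eventually_eq_right (hX j l) (hrc j l))
  exact h1.comp ((hB.comp measurable_snd).prodMk measurable_id)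

namespace BatchNetwork

variable {J : ℕ} {Ω : Type*} [mΩ : MeasurableSpace Ω] {P : Measure Ω}

lemma measurable_interarrival (net : BatchNetwork J P) (i : ℕ) :
    Measurable (interarrival net.T i) := by
  cases i with
  | zero => exact net.measurable_T 0
  | succ i => exact (net.measurable_T (i + 1)).sub (net.measurable_T i)

lemma T_eq_sum_interarrival (net : BatchNetwork J P) (i : ℕ) (ω : Ω) :
    net.T i ω = ∑ l ∈ Finset.range (i + 1), interarrival net.T l ω := by
  induction i with
  | zero => simp [interarrival]
  | succ i ih => rw [Finset.sum_range_succ, ← ih]; simp [interarrival]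

lemma sourceAlgebra_le (net : BatchNetwork J P) (s : Source J) :
    sourceAlgebra net.T net.B net.X s ≤ mΩ := by
  cases s with
  | gap i => exact (net.measurable_interarrival i).comap_le
  | batch i => exact (net.measurable_B i).comap_le
  | customer i j l => exact iSup_le fun t => (net.measurable_X i j l t).comap_le

/-- The sigma-algebra generated by a set of sources of randomness. -/
abbrev sourcesAlgebra (net : BatchNetwork J P) (S : Set (Source J)) : MeasurableSpace Ω :=
  ⨆ s ∈ S, sourceAlgebra net.T net.B net.X s

lemma sourcesAlgebra_le (net : BatchNetwork J P) (S : Set (Source J)) :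
    net.sourcesAlgebra S ≤ mΩ :=
  iSup₂_le fun s _ => net.sourceAlgebra_le s

lemma indep_sourcesAlgebra (net : BatchNetwork J P) {S S' : Set (Source J)} (h : Disjoint S S') :
    Indep (net.sourcesAlgebra S) (net.sourcesAlgebra S') P :=
  indep_iSup_of_disjoint net.sourceAlgebra_le net.indep h

lemma measurable_interarrival_sources (net : BatchNetwork J P) {S : Set (Source J)} {i : ℕ}
    (h : .gap i ∈ S) : Measurable[net.sourcesAlgebra S] (interarrival net.T i) :=
  (comap_measurable (interarrival net.T i)).mono
    (le_iSup₂_of_le (f := fun s (_ : s ∈ S) => sourceAlgebra net.T net.B net.X s) _ h le_rfl) le_rfl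

lemma measurable_B_sources (net : BatchNetwork J P) {S : Set (Source J)} {i : ℕ}
    (h : .batch i ∈ S) : Measurable[net.sourcesAlgebra S] (net.B i) :=
  (comap_measurable (net.B i)).mono
    (le_iSup₂_of_le (f := fun s (_ : s ∈ S) => sourceAlgebra net.T net.B net.X s) _ h le_rfl) le_rfl

lemma measurable_X_sources (net : BatchNetwork J P) {S : Set (Source J)} {i : ℕ} {j : Fin J} {l : ℕ}
    (h : .customer i j l ∈ S) (t : ℝ≥0) : Measurable[net.sourcesAlgebra S, ⊤] (net.X i j l t) := by
  refine (measurable_iff_comap_le.2 le_rfl : Measurable[MeasurableSpace.comap _ ⊤, ⊤] _).mono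
    (le_trans ?_ (le_iSup₂_of_le
    (f := fun s (_ : s ∈ S) => sourceAlgebra net.T net.B net.X s) _ h le_rfl)) le_rfl
  exact le_iSup (fun t => MeasurableSpace.comap (net.X i j l t) ⊤) t

/-- The sources of randomness for the `i`-th batch and its customers. -/
def batchSources (J i : ℕ) : Set (Source J) :=
  {s | s = .batch i ∨ ∃ j l, s = .customer i j l}

/-- All gaps, together with the sources of randomness for the first `n` batches. -/
def pastSources (J n : ℕ) : Set (Source J) :=
  {s | (∃ i, s = .gap i) ∨ ∃ i < n, s ∈ batchSources J i}

lemma disjoint_pastSources (J n : ℕ) : Disjoint (pastSources J n) (batchSources J n) := by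
  rw [Set.disjoint_left]
  rintro s (⟨i, rfl⟩ | ⟨i, hi, rfl | ⟨j, l, rfl⟩⟩) (h | ⟨j', l', h⟩) <;> simp at h
  all_goals omega

lemma iIndepFun_interarrival (net : BatchNetwork J P) : iIndepFun (interarrival net.T) P := by
  rw [iIndepFun_iff_iIndep]
  exact net.indep.precomp (g := Source.gap) fun a b h => by simpa using h

lemma q_nonneg (net : BatchNetwork J P) (j k : Fin J) (t : ℝ≥0) : 0 ≤ net.q j k t := by
  rw [← net.law_X 0 j 0 t k]
  exact measureReal_nonneg

/-- The probability generating function of the position of a customer who entered at queue `j`. -/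
def customerGen (net : BatchNetwork J P) (z : Fin J → ℝ) (j : Fin J) (t : ℝ≥0) : ℝ :=
  1 - ∑ k, net.q j k t * (1 - z k)

lemma customerGen_le_one (net : BatchNetwork J P) {z : Fin J → ℝ} (hz : ∀ k, z k ≤ 1) (j : Fin J)
    (t : ℝ≥0) : net.customerGen z j t ≤ 1 := by
  have : 0 ≤ ∑ k, net.q j k t * (1 - z k) :=
    Finset.sum_nonneg fun k _ => mul_nonneg (net.q_nonneg j k t) (sub_nonneg.2 (hz k))
  unfold customerGen
  linarith

variable [IsProbabilityMeasure P]

lemma integral_customerWeight (net : BatchNetwork J P) (z : Fin J → ℝ) (i : ℕ) (j : Fin J) (l : ℕ)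
    (t : ℝ≥0) : ∫ ω, customerWeight z (net.X i j l t ω) ∂P = net.customerGen z j t := by
  let _ : MeasurableSpace (Option (Fin J)) := ⊤
  have _ : MeasurableSingletonClass (Option (Fin J)) := ⟨fun _ => trivial⟩
  have hX := net.measurable_X i j l t
  have := Measure.isProbabilityMeasure_map (μ := P) hX.aemeasurable
  have hint : ∀ f : Option (Fin J) → ℝ, ∫ ω, f (net.X i j l t ω) ∂P =
      (P.map (net.X i j l t)).real {none} * f none + ∑ k, net.q j k t * f (some k) := by
    intro f
    rw [← integral_map hX.aemeasurable (measurable_from_top (f := f)).aestronglyMeasurable,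
      integral_fintype (Integrable.of_finite), Fintype.sum_option]
    simp only [smul_eq_mul]
    congr 1
    refine Finset.sum_congr rfl fun k _ => ?_
    rw [← net.law_X i j l t k, map_measureReal_apply hX (measurableSet_singleton _)]
    rfl
  have h1 := hint fun _ => 1
  simp only [integral_const, probReal_univ, smul_eq_mul, mul_one] at h1
  rw [hint]
  simp only [customerWeight, customerGen, mul_sub, mul_one, Finset.sum_sub_distrib]
  linarith

lemma lintegral_customerWeight (net : BatchNetwork J P) {z : Fin J → ℝ} (hz : ∀ k, 0 ≤ z k) (i : ℕ)
    (j : Fin J) (l : ℕ) (t : ℝ≥0) :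
    ∫⁻ ω, ENNReal.ofReal (customerWeight z (net.X i j l t ω)) ∂P
      = ENNReal.ofReal (net.customerGen z j t) := by
  let _ : MeasurableSpace (Option (Fin J)) := ⊤
  rw [← net.integral_customerWeight z i j l t, ofReal_integral_eq_lintegral_ofReal]
  · refine ⟨((measurable_from_top (f := customerWeight z)).comp
      (net.measurable_X i j l t)).aestronglyMeasurable, ?_⟩
    obtain ⟨c, hc⟩ := (Set.finite_range (customerWeight z)).isBounded.exists_norm_le
    exact HasFiniteIntegral.of_bounded (C := c)
      (Eventually.of_forall fun ω => hc _ (Set.mem_range_self _))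
  · exact Eventually.of_forall fun ω => customerWeight_nonneg hz _

lemma customerGen_nonneg (net : BatchNetwork J P) {z : Fin J → ℝ} (hz : ∀ k, 0 ≤ z k) (j : Fin J)
    (t : ℝ≥0) : 0 ≤ net.customerGen z j t := by
  rw [← net.integral_customerWeight z 0 j 0 t]
  exact integral_nonneg fun ω => customerWeight_nonneg hz _

lemma isProbabilityMeasure_batchLaw (net : BatchNetwork J P) :
    IsProbabilityMeasure net.batchLaw := (net.law_B 0).isProbabilityMeasure_iff.1 ‹_›

/-- The probability generating function of the contribution of a batch at time `t` after its
arrival. -/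
noncomputable def batchGen (net : BatchNetwork J P) (z : Fin J → ℝ) (t : ℝ≥0) : ℝ :=
  ∫ S, ∏ j, net.customerGen z j t ^ S j ∂net.batchLaw

lemma prod_customerGen_mem (net : BatchNetwork J P) {z : Fin J → ℝ} (hz0 : ∀ k, 0 ≤ z k)
    (hz1 : ∀ k, z k ≤ 1) (t : ℝ≥0) (S : Fin J → ℕ) :
    ∏ j, net.customerGen z j t ^ S j ∈ Set.Icc (0 : ℝ) 1 :=
  ⟨Finset.prod_nonneg fun j _ => pow_nonneg (net.customerGen_nonneg hz0 j t) _,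
    Finset.prod_le_one (fun j _ => pow_nonneg (net.customerGen_nonneg hz0 j t) _)
      fun j _ => pow_le_one₀ (net.customerGen_nonneg hz0 j t) (net.customerGen_le_one hz1 j t)⟩

lemma integrable_prod_customerGen (net : BatchNetwork J P) {z : Fin J → ℝ} (hz0 : ∀ k, 0 ≤ z k)
    (hz1 : ∀ k, z k ≤ 1) (t : ℝ≥0) :
    Integrable (fun S : Fin J → ℕ => ∏ j, net.customerGen z j t ^ S j) net.batchLaw := by
  have := net.isProbabilityMeasure_batchLaw
  refine ⟨(measurable_of_countable _).aestronglyMeasurable, HasFiniteIntegral.of_bounded (C := 1)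
    (Eventually.of_forall fun S => ?_)⟩
  obtain ⟨h0, h1⟩ := net.prod_customerGen_mem hz0 hz1 t S
  rwa [Real.norm_of_nonneg h0]

lemma batchGen_nonneg (net : BatchNetwork J P) {z : Fin J → ℝ} (hz : ∀ k, 0 ≤ z k) (t : ℝ≥0) :
    0 ≤ net.batchGen z t :=
  integral_nonneg fun _ =>
    Finset.prod_nonneg fun j _ => pow_nonneg (net.customerGen_nonneg hz j t) _

lemma batchGen_le_one (net : BatchNetwork J P) {z : Fin J → ℝ} (hz0 : ∀ k, 0 ≤ z k)
    (hz1 : ∀ k, z k ≤ 1) (t : ℝ≥0) : net.batchGen z t ≤ 1 := by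
  have := net.isProbabilityMeasure_batchLaw
  calc net.batchGen z t ≤ ∫ _, 1 ∂net.batchLaw :=
        integral_mono (net.integrable_prod_customerGen hz0 hz1 t) (integrable_const _)
          fun _ => (net.prod_customerGen_mem hz0 hz1 t _).2
    _ = 1 := by simp

lemma lintegral_prod_pow_C (net : BatchNetwork J P) {z : Fin J → ℝ} (hz0 : ∀ k, 0 ≤ z k)
    (hz1 : ∀ k, z k ≤ 1) (i : ℕ) (t : ℝ≥0) :
    ∫⁻ ω, ENNReal.ofReal (∏ k, z k ^ net.C i k t ω) ∂P = ENNReal.ofReal (net.batchGen z t) := by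
  let φ : (Fin J → ℕ) → Ω → ℝ≥0∞ := fun b ω =>
    ∏ j, ∏ l ∈ Finset.range (b j), ENNReal.ofReal (customerWeight z (net.X i j l t ω))
  have hC : ∀ ω, ENNReal.ofReal (∏ k, z k ^ net.C i k t ω) = φ (net.B i ω) ω := by
    intro ω
    simp only [C, φ]
    rw [prod_pow_card_eq_prod_customerWeight,
      ENNReal.ofReal_prod_of_nonneg fun j _ =>
        Finset.prod_nonneg fun l _ => customerWeight_nonneg hz0 _]
    exact Finset.prod_congr rfl fun j _ =>
      ENNReal.ofReal_prod_of_nonneg fun l _ => customerWeight_nonneg hz0 _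
  let S : Set (Source J) := {s | ∃ j l, s = .customer i j l}
  have hφ : Measurable[Prod.instMeasurableSpace (m₂ := net.sourcesAlgebra S)]
      fun p : (Fin J → ℕ) × Ω => φ p.1 p.2 :=
    @measurable_prod_range_prod J Ω _ (net.sourcesAlgebra S) _ _ _
      (fun j l ω => ENNReal.ofReal (customerWeight z (net.X i j l t ω))) fun j l =>
      (measurable_customerWeight z (net.measurable_X_sources (S := S) (i := i) (j := j) ⟨j, l, rfl⟩ t)).ennreal_ofReal
  have hind : Indep (MeasurableSpace.comap (net.B i) inferInstance) (net.sourcesAlgebra S) P := by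
    have := net.indep_sourcesAlgebra (S := {.batch i}) (S' := S) (by simp [S])
    rw [sourcesAlgebra, iSup_singleton] at this
    exact this
  have hindX : iIndepFun (fun (p : (_ : Fin J) × ℕ) ω =>
      ENNReal.ofReal (customerWeight z (net.X i p.1 p.2 t ω))) P := by
    rw [iIndepFun_iff_iIndep]
    refine iIndep_of_iIndep_of_le (net.indep.precomp
      (g := fun p : (_ : Fin J) × ℕ => Source.customer i p.1 p.2) ?_) ?_
    · rintro ⟨a, b⟩ ⟨c, d⟩ h
      simpa using h
    · intro p
      refine Measurable.comap_le ?_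
      refine (measurable_customerWeight (m := MeasurableSpace.comap (net.X i p.1 p.2 t) ⊤) z
        (measurable_iff_comap_le.2 le_rfl)).ennreal_ofReal.mono ?_ le_rfl
      exact le_iSup (fun t => MeasurableSpace.comap (net.X i p.1 p.2 t) ⊤) t
  have hinner : ∀ b : Fin J → ℕ, ∫⁻ ω, φ b ω ∂P
      = ENNReal.ofReal (∏ j, net.customerGen z j t ^ b j) := by
    intro b
    have := lintegral_prod_eq_prod_lintegral_of_indepFun
      (Finset.univ.sigma fun j => Finset.range (b j)) _ hindX
      fun p => (measurable_customerWeight z (net.measurable_X i p.1 p.2 t)).ennreal_ofReal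
    simp only [Finset.prod_sigma] at this
    rw [this, ENNReal.ofReal_prod_of_nonneg fun j _ => pow_nonneg (net.customerGen_nonneg hz0 j t) _]
    refine Finset.prod_congr rfl fun j _ => ?_
    simp only [net.lintegral_customerWeight hz0, Finset.prod_const, Finset.card_range]
    rw [ENNReal.ofReal_pow (net.customerGen_nonneg hz0 j t)]
  simp_rw [hC]
  rw [lintegral_freeze_of_indep (net.measurable_B i) (net.sourcesAlgebra_le S) hind hφ]
  simp_rw [hinner]
  rw [batchGen, ofReal_integral_eq_lintegral_ofReal (net.integrable_prod_customerGen hz0 hz1 t)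
    (Eventually.of_forall fun _ => (net.prod_customerGen_mem hz0 hz1 t _).1), ← (net.law_B i).map_eq,
    lintegral_map (measurable_of_countable _) (net.measurable_B i)]

end BatchNetwork

lemma measurable_mul_prod_comp_sub {Ω : Type*} [MeasurableSpace Ω] {Z : Ω → ℝ≥0∞}
    {T : ℕ → Ω → ℝ} {W : ℕ → ℝ → Ω → ℝ≥0∞} {n : ℕ} (hZ : Measurable Z) (hT : ∀ i, Measurable (T i))
    (hW : ∀ i < n, Measurable fun p : ℝ × Ω => W i p.1 p.2) (t : ℝ) :
    Measurable fun ω => (Z ω * ∏ i ∈ Finset.range n, W i (t - T i ω) ω, T n ω) :=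
  (hZ.mul (Finset.measurable_prod _ fun i hi => (hW i (Finset.mem_range.1 hi)).comp
    (((hT i).const_sub t).prodMk measurable_id))).prodMk (hT n)

lemma measurable_fst_mul_comp_sub {Ω : Type*} [MeasurableSpace Ω] {W : ℝ → Ω → ℝ≥0∞}
    (hW : Measurable fun p : ℝ × Ω => W p.1 p.2) (t : ℝ) :
    Measurable fun p : (ℝ≥0∞ × ℝ) × Ω => p.1.1 * W (t - p.1.2) p.2 :=
  (measurable_fst.comp measurable_fst).mul
    (hW.comp (((measurable_snd.comp measurable_fst).const_sub t).prodMk measurable_snd))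

lemma measurable_mul_ofReal_comp_sub {Ω : Type*} [MeasurableSpace Ω] {Z : Ω → ℝ≥0∞} {T : Ω → ℝ}
    {g : ℝ → ℝ} (hZ : Measurable Z) (hT : Measurable T) (hg : Measurable g) (t : ℝ) :
    Measurable fun ω => Z ω * ENNReal.ofReal (g (t - T ω)) :=
  hZ.mul (hg.comp (hT.const_sub t)).ennreal_ofReal

namespace BatchNetwork

variable {J : ℕ} {Ω : Type*} [mΩ : MeasurableSpace Ω] {P : Measure Ω}

/-- The factor that the `i`-th batch contributes to `∏ k, z k ^ N k t` when it arrived at time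
`t - u`. -/
noncomputable def batchFactor (net : BatchNetwork J P) (z : Fin J → ℝ) (i : ℕ) (u : ℝ) (ω : Ω) :
    ℝ≥0∞ :=
  if 0 ≤ u then ENNReal.ofReal (∏ k, z k ^ net.C i k u.toNNReal ω) else 1

lemma batchFactor_le_one (net : BatchNetwork J P) {z : Fin J → ℝ} (hz0 : ∀ k, 0 ≤ z k)
    (hz1 : ∀ k, z k ≤ 1) (i : ℕ) (u : ℝ) (ω : Ω) : net.batchFactor z i u ω ≤ 1 := by
  unfold batchFactor
  split_ifs
  · rw [ENNReal.ofReal_le_one]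
    exact Finset.prod_le_one (fun k _ => pow_nonneg (hz0 k) _) fun k _ => pow_le_one₀ (hz0 k) (hz1 k)
  · exact le_rfl

lemma measurable_batchFactor_aux {Ω : Type*} [MeasurableSpace Ω] {B : Ω → Fin J → ℕ}
    {X : Fin J → ℕ → ℝ≥0 → Ω → Option (Fin J)} (hB : Measurable B)
    (hX : ∀ j l t, Measurable[_, ⊤] (X j l t))
    (hrc : ∀ j l ω t, ∀ᶠ u in 𝓝[≥] t, X j l u ω = X j l t ω) (z : Fin J → ℝ) :
    Measurable fun p : ℝ × Ω => if 0 ≤ p.1 then ENNReal.ofReal (∏ j,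
      ∏ l ∈ Finset.range (B p.2 j), customerWeight z (X j l p.1.toNNReal p.2)) else 1 :=
  Measurable.ite (measurableSet_le measurable_const measurable_fst)
    ((measurable_prod_pow_count hB hX hrc z).comp
      ((measurable_real_toNNReal.comp measurable_fst).prodMk measurable_snd)).ennreal_ofReal
    measurable_const

lemma measurable_batchFactor_sources (net : BatchNetwork J P) (z : Fin J → ℝ) (i : ℕ)
    {S : Set (Source J)} (hS : batchSources J i ⊆ S) :
    Measurable[Prod.instMeasurableSpace (m₂ := net.sourcesAlgebra S)]
      fun p : ℝ × Ω => net.batchFactor z i p.1 p.2 := by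
  have := @measurable_batchFactor_aux J Ω (net.sourcesAlgebra S) (net.B i) (net.X i)
    (net.measurable_B_sources (hS (.inl rfl)))
    (fun j l => net.measurable_X_sources (hS (.inr ⟨j, l, rfl⟩)))
    (net.rightCont_X i) z
  simpa only [batchFactor, C, prod_pow_card_eq_prod_customerWeight] using this

lemma measurable_batchFactor (net : BatchNetwork J P) (z : Fin J → ℝ) (i : ℕ) :
    Measurable fun p : ℝ × Ω => net.batchFactor z i p.1 p.2 := by
  have := measurable_batchFactor_aux (net.measurable_B i) (net.measurable_X i)
    (net.rightCont_X i) z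
  simpa only [batchFactor, C, prod_pow_card_eq_prod_customerWeight] using this

lemma measurable_C (net : BatchNetwork J P) (i : ℕ) (k : Fin J) :
    Measurable fun p : ℝ≥0 × Ω => net.C i k p.1 p.2 := by
  have h1 := measurable_sum_range_sum (f := fun j l (p : ℝ≥0 × Ω) =>
    if net.X i j l p.1 p.2 = some k then 1 else 0) fun j l =>
      (measurable_from_top (f := fun o : Option (Fin J) => if o = some k then 1 else 0)).comp
        (measurable_uncurry_of_eventually_eq_right (net.measurable_X i j l) (net.rightCont_X i j l))
  simp only [C, Finset.card_filter]
  exact h1.comp (((net.measurable_B i).comp measurable_snd).prodMk measurable_id)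

/-- The queue lengths due to the first `n` batches. -/
noncomputable def partialN (net : BatchNetwork J P) (n : ℕ) (k : Fin J) (t : ℝ≥0) (ω : Ω) : ℕ :=
  ∑ i ∈ Finset.range n,
    if net.T i ω ≤ t then net.C i k (t - net.T i ω).toNNReal ω else 0

lemma measurable_C_comp (net : BatchNetwork J P) (i : ℕ) (k : Fin J) {s : Ω → ℝ≥0}
    (hs : Measurable s) : Measurable fun ω => net.C i k (s ω) ω :=
  (net.measurable_C i k).comp (hs.prodMk measurable_id)

lemma measurable_partialN (net : BatchNetwork J P) (n : ℕ) (k : Fin J) (t : ℝ≥0) :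
    Measurable (net.partialN n k t) := by
  refine Finset.measurable_sum _ fun i _ => Measurable.ite
    (measurableSet_le (net.measurable_T i) measurable_const) ?_ measurable_const
  exact net.measurable_C_comp i k ((net.measurable_T i).const_sub (t : ℝ)).real_toNNReal

lemma eventually_batchFactor_eq (net : BatchNetwork J P) (z : Fin J → ℝ) (i : ℕ) (u : ℝ) (ω : Ω) :
    ∀ᶠ v in 𝓝[>] u, net.batchFactor z i v ω = net.batchFactor z i u ω := by
  rcases lt_or_ge u 0 with hu | hu
  · have : ∀ᶠ v in 𝓝[>] u, v < 0 := nhdsWithin_le_nhds (Iio_mem_nhds hu)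
    filter_upwards [this] with v hv
    simp [batchFactor, hu.not_ge, hv.not_ge]
  · have hlim : Tendsto Real.toNNReal (𝓝[>] u) (𝓝[≥] u.toNNReal) := by
      refine tendsto_nhdsWithin_iff.2
        ⟨(continuous_real_toNNReal.tendsto u).mono_left nhdsWithin_le_nhds, ?_⟩
      filter_upwards [self_mem_nhdsWithin] with v hv using Real.toNNReal_le_toNNReal (le_of_lt hv)
    have hall : ∀ᶠ s in 𝓝[≥] u.toNNReal, ∀ j, ∀ l ∈ Finset.range (net.B i ω j),
        net.X i j l s ω = net.X i j l u.toNNReal ω :=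
      eventually_all.2 fun j => (Finset.eventually_all _).2 fun l _ => net.rightCont_X i j l ω _
    filter_upwards [hlim.eventually hall, self_mem_nhdsWithin] with v hv huv
    rw [batchFactor, batchFactor, if_pos hu, if_pos (hu.trans (le_of_lt huv))]
    simp only [C, prod_pow_card_eq_prod_customerWeight]
    congr 1
    refine Finset.prod_congr rfl fun j _ => Finset.prod_congr rfl fun l hl => ?_
    rw [hv j l hl]

lemma prod_batchFactor (net : BatchNetwork J P) {z : Fin J → ℝ} (hz0 : ∀ k, 0 ≤ z k) (n : ℕ)
    (t : ℝ≥0) (ω : Ω) :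
    ∏ i ∈ Finset.range n, net.batchFactor z i (t - net.T i ω) ω
      = ENNReal.ofReal (∏ k, z k ^ net.partialN n k t ω) := by
  simp only [partialN, ← Finset.prod_pow_eq_pow_sum]
  rw [Finset.prod_comm, ENNReal.ofReal_prod_of_nonneg fun i _ =>
    Finset.prod_nonneg fun k _ => pow_nonneg (hz0 k) _]
  refine Finset.prod_congr rfl fun i _ => ?_
  simp only [batchFactor, sub_nonneg]
  split_ifs <;> simp

/-- Almost surely, only finitely many batches arrive up to a given time. -/
lemma ae_eventually_lt_T (net : BatchNetwork J P) (t : ℝ≥0) :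
    ∀ᵐ ω ∂P, ∃ n₀, ∀ n ≥ n₀, (t : ℝ) < net.T n ω := by
  have hnn : ∀ᵐ ω ∂P, ∀ i, 0 ≤ interarrival net.T i ω := by
    refine ae_all_iff.2 fun i => ?_
    have h := ae_expMeasure_nonneg net.rate
    rw [← (net.law_gap i).map_eq] at h
    exact ae_of_ae_map (net.law_gap i).aemeasurable h
  have hmany : ∀ᵐ ω ∂P, ∃ i, (t : ℝ) < interarrival net.T i ω := by
    rw [ae_iff]
    push Not
    set a := expMeasure net.rate (Set.Iic (t : ℝ)) with ha
    have ha1 : a < 1 := by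
      rw [ha, expMeasure_Iic net.rate_pos t.coe_nonneg, ENNReal.ofReal_lt_one]
      linarith [Real.exp_pos (-(net.rate * t))]
    refine le_antisymm (ge_of_tendsto' (ENNReal.tendsto_pow_atTop_nhds_zero_of_lt_one ha1)
      fun n => ?_) (zero_le)
    have h1 := net.iIndepFun_interarrival.measure_inter_preimage_eq_mul
      (Finset.range n) (sets := fun _ => Set.Iic (t : ℝ)) fun _ _ => measurableSet_Iic
    have h2 : ∀ i, P (interarrival net.T i ⁻¹' Set.Iic (t : ℝ)) = a := fun i => by
      rw [← Measure.map_apply (net.measurable_interarrival i) measurableSet_Iic,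
        (net.law_gap i).map_eq]
    simp only [h2, Finset.prod_const, Finset.card_range] at h1
    rw [← h1]
    refine measure_mono fun ω hω => ?_
    simp only [Set.mem_iInter]
    exact fun i _ => hω i
  filter_upwards [hnn, hmany] with ω h0 ⟨i, hi⟩
  refine ⟨i, fun n hn => hi.trans_le ?_⟩
  rw [net.T_eq_sum_interarrival]
  exact Finset.single_le_sum (f := fun l => interarrival net.T l ω) (fun l _ => h0 l)
    (Finset.mem_range.2 (Nat.lt_succ_of_le hn))

lemma ae_eventually_N_eq (net : BatchNetwork J P) (t : ℝ≥0) :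
    ∀ᵐ ω ∂P, ∀ᶠ n in atTop, ∀ k, net.N k t ω = net.partialN n k t ω := by
  filter_upwards [net.ae_eventually_lt_T t] with ω ⟨n₀, h⟩
  filter_upwards [eventually_ge_atTop n₀] with n hn k
  rw [N, tsum_eq_sum (s := Finset.range n)]
  · simp [partialN]
  · intro i hi
    rw [if_neg]
    have : n ≤ i := by simpa using hi
    exact not_le.2 (h i (hn.trans this))

/-- The queue lengths as natural numbers (with value `0` on the null event that they are
infinite). -/
noncomputable def natN (net : BatchNetwork J P) (t : ℝ≥0) (ω : Ω) (k : Fin J) : ℕ :=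
  (net.N k t ω).toNat

lemma ae_N_eq_natN (net : BatchNetwork J P) (t : ℝ≥0) :
    ∀ᵐ ω ∂P, ∀ k, net.N k t ω = net.natN t ω k := by
  filter_upwards [net.ae_eventually_N_eq t] with ω h k
  obtain ⟨n, hn⟩ := h.exists
  simp [natN, hn k]

lemma ae_eventually_partialN_eq (net : BatchNetwork J P) (t : ℝ≥0) :
    ∀ᵐ ω ∂P, ∀ᶠ n in atTop, ∀ k, net.partialN n k t ω = net.natN t ω k := by
  filter_upwards [net.ae_eventually_N_eq t, net.ae_N_eq_natN t] with ω h h'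
  filter_upwards [h] with n hn k
  have := (hn k).symm.trans (h' k)
  exact_mod_cast this

lemma aemeasurable_natN (net : BatchNetwork J P) (t : ℝ≥0) : AEMeasurable (net.natN t) P := by
  refine aemeasurable_pi_lambda _ fun k => ?_
  refine aemeasurable_of_tendsto_metrizable_ae atTop (f := fun n => net.partialN n k t)
    (fun n => (net.measurable_partialN n k t).aemeasurable) ?_
  · filter_upwards [net.ae_eventually_partialN_eq t] with ω h
    refine tendsto_nhds_of_eventually_eq ?_
    filter_upwards [h] with n hn using hn k

variable [IsProbabilityMeasure P]

/-- `batchGen`, extended by `1` to negative times. -/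
noncomputable def ageGen (net : BatchNetwork J P) (z : Fin J → ℝ) (u : ℝ) : ℝ :=
  if 0 ≤ u then net.batchGen z u.toNNReal else 1

lemma ageGen_nonneg (net : BatchNetwork J P) {z : Fin J → ℝ} (hz0 : ∀ k, 0 ≤ z k) (u : ℝ) : 0 ≤ net.ageGen z u := by
  unfold ageGen
  split_ifs
  · exact net.batchGen_nonneg hz0 _
  · exact zero_le_one

section

variable (net : BatchNetwork J P) {z : Fin J → ℝ} (hz0 : ∀ k, 0 ≤ z k) (hz1 : ∀ k, z k ≤ 1)

include hz0 hz1

lemma lintegral_batchFactor (i : ℕ) (u : ℝ) :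
    ∫⁻ ω, net.batchFactor z i u ω ∂P = ENNReal.ofReal (net.ageGen z u) := by
  unfold batchFactor ageGen
  split_ifs
  · exact net.lintegral_prod_pow_C hz0 hz1 i _
  · simp

lemma ageGen_le_one (u : ℝ) : net.ageGen z u ≤ 1 := by
  unfold ageGen
  split_ifs
  · exact net.batchGen_le_one hz0 hz1 _
  · exact le_rfl

lemma ageGen_eq_toReal (u : ℝ) :
    net.ageGen z u = (∫⁻ ω, net.batchFactor z 0 u ω ∂P).toReal := by
  rw [net.lintegral_batchFactor hz0 hz1, ENNReal.toReal_ofReal (net.ageGen_nonneg hz0 u)]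

lemma measurable_ageGen : Measurable (net.ageGen z) := by
  rw [funext (net.ageGen_eq_toReal hz0 hz1)]
  exact (net.measurable_batchFactor z 0).lintegral_prod_right'.ennreal_toReal

lemma continuousWithinAt_ageGen (u : ℝ) : ContinuousWithinAt (net.ageGen z) (Set.Ioi u) u := by
  rw [funext (net.ageGen_eq_toReal hz0 hz1)]
  refine (ENNReal.tendsto_toReal ?_).comp ?_
  · rw [net.lintegral_batchFactor hz0 hz1]
    exact ENNReal.ofReal_ne_top
  · refine tendsto_lintegral_filter_of_dominated_convergence (fun _ => 1)
      (Eventually.of_forall fun v => (net.measurable_batchFactor z 0).comp measurable_prodMk_left)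
      (Eventually.of_forall fun v => Eventually.of_forall fun ω =>
        net.batchFactor_le_one hz0 hz1 0 v ω) (by simp) (Eventually.of_forall fun ω => ?_)
    exact tendsto_nhds_of_eventually_eq (net.eventually_batchFactor_eq z 0 u ω)

/-- Given the arrival times, the batches contribute independently. -/
lemma lintegral_mul_prod_batchFactor (t : ℝ) (n : ℕ) (Z : Ω → ℝ≥0∞)
    (hZ : Measurable[net.sourcesAlgebra {s | ∃ i, s = .gap i}] Z) :
    ∫⁻ ω, Z ω * ∏ i ∈ Finset.range n, net.batchFactor z i (t - net.T i ω) ω ∂P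
      = ∫⁻ ω, Z ω * ∏ i ∈ Finset.range n, ENNReal.ofReal (net.ageGen z (t - net.T i ω)) ∂P := by
  induction n generalizing Z with
  | zero => simp
  | succ n ih =>
    have hT : ∀ {S : Set (Source J)} (i : ℕ), {s | ∃ i, s = .gap i} ⊆ S →
        Measurable[net.sourcesAlgebra S] (net.T i) := by
      intro S i hS
      rw [funext (net.T_eq_sum_interarrival i)]
      exact @Finset.measurable_sum _ _ _ _ _ _ (net.sourcesAlgebra S) _ _ fun l _ =>
        net.measurable_interarrival_sources (hS ⟨l, rfl⟩)
    have hgap : {s | ∃ i, s = .gap i} ⊆ pastSources J n := fun s hs => .inl hs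
    let V : Ω → ℝ≥0∞ × ℝ := fun ω =>
      (Z ω * ∏ i ∈ Finset.range n, net.batchFactor z i (t - net.T i ω) ω, net.T n ω)
    have hV : Measurable[net.sourcesAlgebra (pastSources J n)] V :=
      @measurable_mul_prod_comp_sub Ω (net.sourcesAlgebra (pastSources J n)) _ _
        (net.batchFactor z) _ (hZ.mono (biSup_mono hgap) le_rfl) (fun i => hT i hgap)
        (fun i hi => net.measurable_batchFactor_sources z i fun s hs => .inr ⟨i, hi, hs⟩) t
    let φ : ℝ≥0∞ × ℝ → Ω → ℝ≥0∞ := fun a ω => a.1 * net.batchFactor z n (t - a.2) ω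
    have hφ : Measurable[Prod.instMeasurableSpace (m₂ := net.sourcesAlgebra (batchSources J n))]
        fun p : (ℝ≥0∞ × ℝ) × Ω => φ p.1 p.2 :=
      @measurable_fst_mul_comp_sub Ω (net.sourcesAlgebra (batchSources J n)) (net.batchFactor z n)
        (net.measurable_batchFactor_sources z n subset_rfl) t
    have hind := indep_of_indep_of_le_left (net.indep_sourcesAlgebra (disjoint_pastSources J n))
      hV.comap_le
    have hfreeze := lintegral_freeze_of_indep (hV.mono (net.sourcesAlgebra_le _) le_rfl)
      (net.sourcesAlgebra_le _) hind hφ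
    have hmeas : Measurable (net.ageGen z) := net.measurable_ageGen hz0 hz1
    calc _ = ∫⁻ ω, φ (V ω) ω ∂P := by
          refine lintegral_congr fun ω => ?_
          simp only [φ, V, Finset.prod_range_succ, mul_assoc]
      _ = ∫⁻ ω, Z ω * ENNReal.ofReal (net.ageGen z (t - net.T n ω)) *
            ∏ i ∈ Finset.range n, net.batchFactor z i (t - net.T i ω) ω ∂P := by
          rw [hfreeze]
          refine lintegral_congr fun ω => ?_
          have hm : Measurable fun ω' => net.batchFactor z n (t - net.T n ω) ω' :=
            (net.measurable_batchFactor z n).comp measurable_prodMk_left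
          simp only [φ, V]
          rw [lintegral_const_mul _ hm,
            net.lintegral_batchFactor hz0 hz1]
          ring
      _ = _ := by
          rw [ih (fun ω => Z ω * ENNReal.ofReal (net.ageGen z (t - net.T n ω)))]
          · refine lintegral_congr fun ω => ?_
            simp only [Finset.prod_range_succ]
            ring
          · exact @measurable_mul_ofReal_comp_sub Ω (net.sourcesAlgebra {s | ∃ i, s = .gap i}) _ _ _
              hZ (hT n subset_rfl) hmeas t

lemma tendsto_lintegral_prod_batchFactor (t : ℝ≥0) :
    Tendsto (fun n => ∫⁻ ω, ∏ i ∈ Finset.range n, net.batchFactor z i (t - net.T i ω) ω ∂P) atTop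
      (𝓝 (ENNReal.ofReal (poissonFunctional net.rate (net.ageGen z) t))) := by
  have hm := net.measurable_ageGen hz0 hz1
  refine (tendsto_renewalIter_expMeasure net.rate_pos hm (net.ageGen_nonneg hz0)
    (net.ageGen_le_one hz0 hz1) (fun s hs => by simp [ageGen, hs.not_ge])
    (net.continuousWithinAt_ageGen hz0 hz1) t.coe_nonneg).congr fun n => ?_
  have h1 := net.lintegral_mul_prod_batchFactor hz0 hz1 t n (fun _ => 1)
    (@measurable_const _ _ _ (net.sourcesAlgebra {s | ∃ i, s = .gap i}) _)
  have h2 := (lintegral_prod_partialSums_eq_renewalIter net.measurable_interarrival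
    net.iIndepFun_interarrival (fun i => (net.law_gap i).map_eq) hm.ennreal_ofReal n).2 0 t
  simp only [one_mul, zero_add] at h1 h2
  rw [h1, ← h2]
  simp only [net.T_eq_sum_interarrival]

end

/-- The generating function of the queue lengths. -/
lemma lintegral_prod_pow_natN (net : BatchNetwork J P) {z : Fin J → ℝ} (hz0 : ∀ k, 0 ≤ z k)
    (hz1 : ∀ k, z k ≤ 1) (t : ℝ≥0) :
    ∫⁻ ω, ENNReal.ofReal (∏ k, z k ^ net.natN t ω k) ∂P
      = ENNReal.ofReal (poissonFunctional net.rate (net.ageGen z) t) := by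
  refine tendsto_nhds_unique (tendsto_lintegral_of_dominated_convergence (fun _ => 1)
    (fun n => ?_) (fun n => Eventually.of_forall fun ω => ?_) (by simp) ?_)
    (net.tendsto_lintegral_prod_batchFactor hz0 hz1 t)
  · refine Finset.measurable_prod _ fun i _ => ?_
    exact (net.measurable_batchFactor z i).comp
      (((net.measurable_T i).const_sub (t : ℝ)).prodMk measurable_id)
  · exact Finset.prod_le_one' fun i _ => net.batchFactor_le_one hz0 hz1 i _ ω
  · filter_upwards [net.ae_eventually_partialN_eq t] with ω h
    refine tendsto_nhds_of_eventually_eq ?_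
    filter_upwards [h] with n hn
    rw [net.prod_batchFactor hz0]
    simp only [hn]

end BatchNetwork

/-- The embedding of `ℕ^J` into the cube by `n ↦ 2⁻ⁿ` in every coordinate. -/
noncomputable def dyadicPoint {J : ℕ} (S : Fin J → ℕ) (k : Fin J) : unitInterval :=
  ⟨(1 / 2) ^ S k, by positivity, pow_le_one₀ (by norm_num) (by norm_num)⟩

lemma exists_prod_pow_of_mem_closure_coordinates {J : ℕ} {f : C(Fin J → unitInterval, ℝ)}
    (hf : f ∈ Submonoid.closure (Set.range fun k : Fin J =>
      (⟨fun x => (x k : ℝ), by fun_prop⟩ : C(Fin J → unitInterval, ℝ)))) :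
    ∃ m : Fin J → ℕ, ∀ x, f x = ∏ k, (x k : ℝ) ^ m k := by
  induction hf using Submonoid.closure_induction with
  | mem f hf =>
    obtain ⟨k, rfl⟩ := hf
    refine ⟨Pi.single k 1, fun x => ?_⟩
    rw [Finset.prod_eq_single k]
    · simp
    · intro j _ hj
      simp [hj]
    · simp
  | one => exact ⟨0, fun x => by simp⟩
  | mul f g _ _ hf hg =>
    obtain ⟨m, hm⟩ := hf
    obtain ⟨m', hm'⟩ := hg
    exact ⟨m + m', fun x => by simp [hm, hm', pow_add, Finset.prod_mul_distrib]⟩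

/-- Convergence of the integrals of a set of functions extends to its uniform closure. -/
lemma exists_tendsto_integral_of_mem_closure {X ι : Type*} [TopologicalSpace X] [CompactSpace X]
    {A : Type*} [MeasurableSpace A] {l : Filter ι} [l.NeBot] {μ : ι → Measure A}
    [∀ i, IsProbabilityMeasure (μ i)] {x : A → X} (hx : ∀ f : C(X, ℝ), Measurable fun a => f (x a))
    {s : Set C(X, ℝ)} (hs : ∀ f ∈ s, ∃ c, Tendsto (fun i => ∫ a, f (x a) ∂μ i) l (𝓝 c))
    {f : C(X, ℝ)} (hf : f ∈ closure s) : ∃ c, Tendsto (fun i => ∫ a, f (x a) ∂μ i) l (𝓝 c) := by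
  have hint : ∀ (g : C(X, ℝ)) (i : ι), Integrable (fun a => g (x a)) (μ i) := fun g i =>
    ⟨(hx g).aestronglyMeasurable, HasFiniteIntegral.of_bounded (C := ‖g‖)
      (Eventually.of_forall fun a => g.norm_coe_le_norm _)⟩
  have hdist : ∀ (g : C(X, ℝ)) (i : ι), dist (∫ a, f (x a) ∂μ i) (∫ a, g (x a) ∂μ i) ≤ dist f g := by
    intro g i
    rw [dist_eq_norm, ← integral_sub (hint f i) (hint g i), dist_eq_norm]
    refine (norm_integral_le_of_norm_le_const (C := ‖f - g‖)
      (Eventually.of_forall fun a => (f - g).norm_coe_le_norm (x a))).trans_eq ?_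
    simp
  refine cauchy_map_iff_exists_tendsto.1 (Metric.cauchy_iff.2 ⟨inferInstance, fun ε hε => ?_⟩)
  obtain ⟨g, hg, hfg⟩ := Metric.mem_closure_iff.1 hf (ε / 3) (by positivity)
  obtain ⟨c, hc⟩ := hs g hg
  refine ⟨_, image_mem_map (Metric.tendsto_nhds.1 hc (ε / 6) (by positivity)), ?_⟩
  rintro _ ⟨i, hi, rfl⟩ _ ⟨j, hj, rfl⟩
  have h1 := hdist g i
  have h2 := hdist g j
  have hi : dist (∫ a, g (x a) ∂μ i) c < ε / 6 := hi
  have hj : dist (∫ a, g (x a) ∂μ j) c < ε / 6 := hj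
  rw [dist_comm] at h2 hj
  have h3 := dist_triangle4 (∫ a, f (x a) ∂μ i) (∫ a, g (x a) ∂μ i) c (∫ a, g (x a) ∂μ j)
  have h4 := dist_triangle (∫ a, f (x a) ∂μ i) (∫ a, g (x a) ∂μ j) (∫ a, f (x a) ∂μ j)
  exact h4.trans_lt (by linarith)

lemma exists_continuousMap_dyadicPoint_eq_ite {J : ℕ} (n : Fin J → ℕ) :
    ∃ f : C(Fin J → unitInterval, ℝ), ∀ S, f (dyadicPoint S) = if S = n then 1 else 0 := by
  refine ⟨⟨fun x => ∏ k, max 0 (1 - 2 ^ (n k + 1) * |(x k : ℝ) - (1 / 2) ^ n k|), by fun_prop⟩,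
    fun S => ?_⟩
  simp only [ContinuousMap.coe_mk, dyadicPoint]
  split_ifs with h
  · subst h
    simp
  · obtain ⟨k, hk⟩ := Function.ne_iff.1 h
    refine Finset.prod_eq_zero (Finset.mem_univ k) (max_eq_left (sub_nonpos.2 ?_))
    have hp : (0 : ℝ) < 2 ^ (n k + 1) := by positivity
    have key : (1 / 2 : ℝ) ^ (n k + 1) ≤ |(1 / 2 : ℝ) ^ S k - (1 / 2) ^ n k| := by
      rcases lt_or_gt_of_ne hk with hlt | hlt
      · have h1 : (1 / 2 : ℝ) ^ (n k) ≤ (1 / 2) ^ (S k + 1) :=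
          pow_le_pow_of_le_one (by norm_num) (by norm_num) hlt
        rw [pow_succ] at h1 ⊢
        refine le_trans ?_ (le_abs_self _)
        have : (0 : ℝ) ≤ (1 / 2) ^ (n k) := by positivity
        linarith
      · have h1 : (1 / 2 : ℝ) ^ (S k) ≤ (1 / 2) ^ (n k + 1) :=
          pow_le_pow_of_le_one (by norm_num) (by norm_num) hlt
        rw [pow_succ] at h1 ⊢
        refine le_trans ?_ (neg_le_abs _)
        linarith
    calc (1 : ℝ) = 2 ^ (n k + 1) * (1 / 2) ^ (n k + 1) := by rw [← mul_pow]; norm_num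
      _ ≤ _ := by gcongr

/-- Continuity theorem for probability generating functions on `ℕ^J`: pointwise convergence to a
limit that is continuous at `1` along the diagonal implies convergence in distribution. -/
theorem exists_pmf_tendsto_of_tendsto_genFun {J : ℕ} {ι : Type*} {l : Filter ι} [l.NeBot]
    (μ : ι → Measure (Fin J → ℕ)) [∀ i, IsProbabilityMeasure (μ i)] (L : (Fin J → ℝ) → ℝ≥0∞)
    (hL : ∀ z : Fin J → ℝ, (∀ k, 0 ≤ z k) → (∀ k, z k ≤ 1) →
      Tendsto (fun i => ∫⁻ S, ENNReal.ofReal (∏ k, z k ^ S k) ∂μ i) l (𝓝 (L z)))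
    (hL1 : Tendsto (fun m : ℕ => L fun _ => 1 - 1 / ((m : ℝ) + 1)) atTop (𝓝 1)) :
    ∃ π : PMF (Fin J → ℕ), ∀ n, Tendsto (fun i => μ i {n}) l (𝓝 (π n)) := by
  have hle1 : ∀ (z : Fin J → ℝ), (∀ k, 0 ≤ z k) → (∀ k, z k ≤ 1) → ∀ i,
      ∫⁻ S, ENNReal.ofReal (∏ k, z k ^ S k) ∂μ i ≤ 1 := by
    intro z h0 h1 i
    calc _ ≤ ∫⁻ _, 1 ∂μ i := lintegral_mono fun S => ENNReal.ofReal_le_one.2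
          (Finset.prod_le_one (fun k _ => pow_nonneg (h0 k) _) fun k _ => pow_le_one₀ (h0 k) (h1 k))
      _ = 1 := by simp
  have hconv : ∀ f : C(Fin J → unitInterval, ℝ),
      ∃ c, Tendsto (fun i => ∫ S, f (dyadicPoint S) ∂μ i) l (𝓝 c) := by
    let gens : Set C(Fin J → unitInterval, ℝ) :=
      Set.range fun k : Fin J => ⟨fun x => (x k : ℝ), by fun_prop⟩
    have hsep : (Algebra.adjoin ℝ gens).SeparatesPoints := by
      intro x y hxy
      obtain ⟨k, hk⟩ := Function.ne_iff.1 hxy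
      refine ⟨fun x => (x k : ℝ), ⟨⟨fun x => (x k : ℝ), by fun_prop⟩,
        Algebra.subset_adjoin ⟨k, rfl⟩, rfl⟩, fun h => hk (Subtype.ext h)⟩
    have htop := ContinuousMap.subalgebra_topologicalClosure_eq_top_of_separatesPoints _ hsep
    intro f
    have hf : f ∈ (Algebra.adjoin ℝ gens).topologicalClosure := htop ▸ Algebra.mem_top
    refine exists_tendsto_integral_of_mem_closure (fun f => measurable_of_countable _) ?_ hf
    intro g hgA
    have hint : ∀ (g : C(Fin J → unitInterval, ℝ)) (i : ι),
        Integrable (fun S => g (dyadicPoint S)) (μ i) := fun g i =>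
      ⟨(measurable_of_countable _).aestronglyMeasurable, HasFiniteIntegral.of_bounded (C := ‖g‖)
        (Eventually.of_forall fun a => g.norm_coe_le_norm _)⟩
    have hg : g ∈ Submodule.span ℝ (Submonoid.closure gens : Set C(Fin J → unitInterval, ℝ)) := by
      rw [← Algebra.adjoin_eq_span]
      exact hgA
    clear hgA
    induction hg using Submodule.span_induction with
    | mem g hg =>
      obtain ⟨m, hm⟩ := exists_prod_pow_of_mem_closure_coordinates hg
      have hz0 : ∀ k, (0 : ℝ) ≤ (1 / 2) ^ m k := fun k => by positivity
      have hz1 : ∀ k, (1 / 2 : ℝ) ^ m k ≤ 1 := fun k => pow_le_one₀ (by norm_num) (by norm_num)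
      have h1 := hL (fun k => (1 / 2) ^ m k) hz0 hz1
      have hLle : L (fun k => (1 / 2) ^ m k) ≤ 1 := le_of_tendsto' h1 (hle1 _ hz0 hz1)
      refine ⟨_, ((ENNReal.tendsto_toReal (hLle.trans_lt ENNReal.one_lt_top).ne).comp h1).congr
        fun i => ?_⟩
      simp only [Function.comp]
      rw [← integral_eq_lintegral_of_nonneg_ae]
      · refine integral_congr_ae (Eventually.of_forall fun S => ?_)
        simp only [hm, dyadicPoint, ← pow_mul, mul_comm]
      · exact Eventually.of_forall fun S => Finset.prod_nonneg fun k _ => pow_nonneg (hz0 k) _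
      · exact (measurable_of_countable _).aestronglyMeasurable
    | zero => exact ⟨0, by simp⟩
    | add g g' _ _ hg hg' =>
      obtain ⟨c, hc⟩ := hg
      obtain ⟨c', hc'⟩ := hg'
      refine ⟨c + c', (hc.add hc').congr fun i => ?_⟩
      rw [← integral_add (hint g i) (hint g' i)]
      rfl
    | smul a g _ hg =>
      obtain ⟨c, hc⟩ := hg
      refine ⟨a * c, (hc.const_mul a).congr fun i => ?_⟩
      rw [← integral_const_mul]
      rfl
  have hpoint : ∀ n, ∃ q : ℝ≥0∞, Tendsto (fun i => μ i {n}) l (𝓝 q) := by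
    intro n
    obtain ⟨f, hf⟩ := exists_continuousMap_dyadicPoint_eq_ite n
    obtain ⟨c, hc⟩ := hconv f
    refine ⟨ENNReal.ofReal c, (ENNReal.tendsto_ofReal hc).congr fun i => ?_⟩
    have : (fun S => f (dyadicPoint S)) = Set.indicator {n} fun _ => (1 : ℝ) := by
      ext S
      simp [hf, Set.indicator_apply]
    rw [this, integral_indicator (measurableSet_singleton n)]
    simp
  choose q hq using hpoint
  have hsum : ∀ F : Finset (Fin J → ℕ), Tendsto (fun i => μ i F) l (𝓝 (∑ n ∈ F, q n)) := fun F =>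
    (tendsto_finsetSum F fun n _ => hq n).congr fun i => sum_measure_singleton
  have hle : ∑' n, q n ≤ 1 := by
    rw [ENNReal.tsum_eq_iSup_sum]
    exact iSup_le fun F => le_of_tendsto' (hsum F) fun i => prob_le_one
  have hge : 1 ≤ ∑' n, q n := by
    refine le_of_tendsto' hL1 fun m => ?_
    set w : ℝ := 1 - 1 / ((m : ℝ) + 1) with hw
    have hw0 : 0 ≤ w := by
      rw [hw, sub_nonneg, div_le_one (by positivity)]
      linarith [(Nat.cast_nonneg m : (0 : ℝ) ≤ m)]
    have hw1 : w < 1 := by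
      rw [hw, sub_lt_self_iff]
      positivity
    have hbound : ∀ R : ℕ, L (fun _ => w) ≤ ∑' n, q n + ENNReal.ofReal w ^ R := by
      intro R
      let F : Finset (Fin J → ℕ) := Fintype.piFinset fun _ => Finset.range R
      refine le_of_tendsto_of_tendsto' (hL _ (fun _ => hw0) fun _ => hw1.le)
        ((hsum F).add_const (ENNReal.ofReal w ^ R)) (fun i => ?_) |>.trans ?_
      · calc _ ≤ ∫⁻ S, ((F : Set (Fin J → ℕ)).indicator (fun _ => 1) S + ENNReal.ofReal w ^ R)
              ∂μ i := by
              refine lintegral_mono fun S => ?_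
              by_cases hS : S ∈ F
              · rw [Set.indicator_of_mem (by exact hS)]
                refine le_add_right (ENNReal.ofReal_le_one.2 ?_)
                exact Finset.prod_le_one (fun k _ => pow_nonneg hw0 _)
                  fun k _ => pow_le_one₀ hw0 hw1.le
              · rw [Set.indicator_of_notMem (by exact hS), zero_add,
                  ← ENNReal.ofReal_pow hw0, Finset.prod_pow_eq_pow_sum]
                refine ENNReal.ofReal_le_ofReal (pow_le_pow_of_le_one hw0 hw1.le ?_)
                simp only [F, Fintype.mem_piFinset, Finset.mem_range, not_forall, not_lt] at hS
                obtain ⟨k, hk⟩ := hS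
                exact hk.trans (Finset.single_le_sum (fun _ _ => Nat.zero_le _) (Finset.mem_univ k))
          _ = _ := by
              rw [lintegral_add_right _ measurable_const,
                lintegral_indicator F.measurableSet]
              simp
      · gcongr
        exact ENNReal.sum_le_tsum F
    have hlim : Tendsto (fun R => ∑' n, q n + ENNReal.ofReal w ^ R) atTop (𝓝 (∑' n, q n)) := by
      simpa using tendsto_const_nhds.add
        (ENNReal.tendsto_pow_atTop_nhds_zero_of_lt_one (ENNReal.ofReal_lt_one.2 hw1))
    exact ge_of_tendsto' hlim hbound
  exact ⟨⟨q, (le_antisymm hle hge) ▸ ENNReal.summable.hasSum⟩, hq⟩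

lemma one_sub_sum_one_sub_le_prod {ι : Type*} (s : Finset ι) {x : ι → ℝ} (h0 : ∀ i, 0 ≤ x i)
    (h1 : ∀ i, x i ≤ 1) : 1 - ∑ i ∈ s, (1 - x i) ≤ ∏ i ∈ s, x i := by
  induction s using Finset.cons_induction with
  | empty => simp
  | cons a s ha ih =>
    rw [Finset.sum_cons, Finset.prod_cons]
    have hp : ∏ i ∈ s, x i ≤ 1 := Finset.prod_le_one (fun i _ => h0 i) fun i _ => h1 i
    nlinarith [h0 a, h1 a]

lemma prod_one_sub_pow_bounds {J : ℕ} {a : Fin J → ℝ} (h0 : ∀ j, 0 ≤ a j) (h1 : ∀ j, a j ≤ 1)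
    (S : Fin J → ℕ) :
    1 - ∑ j, S j * a j ≤ ∏ j, (1 - a j) ^ S j ∧
      ∏ j, (1 - a j) ^ S j ≤ (1 + ∑ j, S j * a j)⁻¹ := by
  have hx0 : ∀ j, 0 ≤ (1 - a j) ^ S j := fun j => pow_nonneg (by linarith [h1 j]) _
  constructor
  · refine le_trans (sub_le_sub_left (Finset.sum_le_sum fun j _ => ?_) 1)
      (one_sub_sum_one_sub_le_prod Finset.univ hx0 fun j =>
        pow_le_one₀ (by linarith [h1 j]) (by linarith [h0 j]))
    have := one_add_mul_le_pow (a := -a j) (by linarith [h1 j]) (S j)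
    rw [← sub_eq_add_neg] at this
    linarith
  · have hsum : 0 ≤ ∑ j, S j * a j := Finset.sum_nonneg fun j _ => by have := h0 j; positivity
    calc ∏ j, (1 - a j) ^ S j ≤ ∏ j, Real.exp (-(S j * a j)) := by
          refine Finset.prod_le_prod (fun j _ => hx0 j) fun j _ => ?_
          rw [← mul_neg, Real.exp_nat_mul]
          exact pow_le_pow_left₀ (by linarith [h1 j]) (Real.one_sub_le_exp_neg _) _
      _ = (Real.exp (∑ j, S j * a j))⁻¹ := by
          rw [← Real.exp_sum, Finset.sum_neg_distrib, Real.exp_neg]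
      _ ≤ _ := by
          refine inv_anti₀ (by linarith) ?_
          rw [add_comm]
          exact Real.add_one_le_exp _

lemma min_one_le_two_mul_div {x y : ℝ} (hx : 0 ≤ x) (h1 : y ≤ 1) (hy : y ≤ x) :
    y ≤ 2 * (x / (1 + x)) := by
  rw [mul_div_assoc', le_div_iff₀ (by linarith)]
  rcases le_total x 1 with h | h <;> nlinarith

lemma lintegral_logistic {δ a : ℝ} (hδ : 0 < δ) (ha : 0 ≤ a) (s₀ : ℝ) :
    ∫⁻ s in Set.Ioi s₀, ENNReal.ofReal (a * Real.exp (-(δ * s)) / (1 + a * Real.exp (-(δ * s))))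
      = ENNReal.ofReal (Real.log (1 + a * Real.exp (-(δ * s₀))) / δ) := by
  have hpos : ∀ s, 0 < 1 + a * Real.exp (-(δ * s)) := fun s => by positivity
  have hderiv : ∀ s ∈ Set.Ici s₀, HasDerivAt
      (fun s => -(Real.log (1 + a * Real.exp (-(δ * s))) / δ))
      (a * Real.exp (-(δ * s)) / (1 + a * Real.exp (-(δ * s)))) s := by
    intro s _
    have h1 : HasDerivAt (fun s => -(δ * s)) (-δ) s :=
      ((hasDerivAt_id s).const_mul δ).neg.congr_deriv (by simp)
    refine ((((h1.exp.const_mul a).const_add 1).log (hpos s).ne').div_const δ).neg.congr_deriv ?_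
    have := (hpos s).ne'
    field_simp
  have hnn : ∀ s, 0 ≤ a * Real.exp (-(δ * s)) / (1 + a * Real.exp (-(δ * s))) := fun s => by
    have := hpos s
    positivity
  have hlim : Tendsto (fun s => -(Real.log (1 + a * Real.exp (-(δ * s))) / δ)) atTop (𝓝 0) := by
    have h1 : Tendsto (fun s => 1 + a * Real.exp (-(δ * s))) atTop (𝓝 (1 + a * 0)) :=
      ((Real.tendsto_exp_neg_atTop_nhds_zero.comp
        (tendsto_id.const_mul_atTop hδ)).const_mul a).const_add 1
    have h2 := ((h1.log (by simp)).div_const δ).neg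
    simpa using h2
  rw [← ofReal_integral_eq_lintegral_ofReal
    (integrableOn_Ioi_deriv_of_nonneg' hderiv (fun s _ => hnn s) hlim)
    (Eventually.of_forall hnn),
    integral_Ioi_of_hasDerivAt_of_nonneg' hderiv (fun s _ => hnn s) hlim]
  simp

/-- Finiteness of a logarithmic moment does not depend on the scale. -/
lemma lintegral_log_one_add_mul_lt_top {A : Type*} [MeasurableSpace A] {μ : Measure A}
    [IsFiniteMeasure μ] {f : A → ℝ} (hf : ∀ x, 0 ≤ f x) {a b : ℝ} (ha : 0 ≤ a) (hb : 0 < b)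
    (h : ∫⁻ x, ENNReal.ofReal (Real.log (1 + b * f x)) ∂μ < ∞) :
    ∫⁻ x, ENNReal.ofReal (Real.log (1 + a * f x)) ∂μ < ∞ := by
  calc ∫⁻ x, ENNReal.ofReal (Real.log (1 + a * f x)) ∂μ
      ≤ ∫⁻ x, (ENNReal.ofReal (Real.log (1 + a / b)) + ENNReal.ofReal (Real.log (1 + b * f x))) ∂μ := by
        refine lintegral_mono fun x => ?_
        have hx := hf x
        rw [← ENNReal.ofReal_add (Real.log_nonneg (by simp; positivity))
          (Real.log_nonneg (by simp; positivity)), ← Real.log_mul (by positivity) (by positivity)]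
        refine ENNReal.ofReal_le_ofReal (Real.log_le_log (by positivity) ?_)
        have : (1 + a / b) * (1 + b * f x) = 1 + b * f x + a / b + a * f x := by
          field_simp
          ring
        rw [this]
        have : 0 ≤ a / b := by positivity
        nlinarith
    _ < ∞ := by
        rw [lintegral_add_left measurable_const, lintegral_const]
        exact ENNReal.add_lt_top.2
          ⟨ENNReal.mul_lt_top ENNReal.ofReal_lt_top (measure_lt_top _ _), h⟩

lemma tendsto_lintegral_log_one_add_mul {A : Type*} [MeasurableSpace A] {μ : Measure A}
    {f : A → ℝ} (hfm : Measurable f) (hf : ∀ x, 0 ≤ f x) {c b : ℝ} (hc : 0 ≤ c) (hb : 0 ≤ b)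
    (h : ∫⁻ x, ENNReal.ofReal (c * Real.log (1 + b * f x)) ∂μ ≠ ∞) {u : ℕ → ℝ}
    (hu0 : ∀ m, 0 ≤ u m) (hu1 : ∀ m, u m ≤ 1) (hu : Tendsto u atTop (𝓝 0)) :
    Tendsto (fun m => ∫⁻ x, ENNReal.ofReal (c * Real.log (1 + u m * b * f x)) ∂μ) atTop (𝓝 0) := by
  have := tendsto_lintegral_of_dominated_convergence (μ := μ)
    (F := fun m x => ENNReal.ofReal (c * Real.log (1 + u m * b * f x))) (f := fun _ => 0)
    (fun x => ENNReal.ofReal (c * Real.log (1 + b * f x))) (fun m => by fun_prop)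
    (fun m => Eventually.of_forall fun x => ?_) h (Eventually.of_forall fun x => ?_)
  · simpa using this
  · have := hf x
    have := hu0 m
    refine ENNReal.ofReal_le_ofReal (mul_le_mul_of_nonneg_left
      (Real.log_le_log (by positivity) ?_) hc)
    gcongr
    exact mul_le_of_le_one_left hb (hu1 m)
  · have h1 : Tendsto (fun m => 1 + u m * b * f x) atTop (𝓝 (1 + 0 * b * f x)) :=
      ((hu.mul_const b).mul_const (f x)).const_add 1
    have h2 := ENNReal.tendsto_ofReal ((h1.log (by simp)).const_mul c)
    simpa using h2

namespace BatchNetwork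

variable {J : ℕ} {Ω : Type*} [MeasurableSpace Ω] {P : Measure Ω}

lemma Q_nonneg (net : BatchNetwork J P) (j : Fin J) (t : ℝ≥0) : 0 ≤ net.Q j t :=
  Finset.sum_nonneg fun k _ => net.q_nonneg j k t

variable [IsProbabilityMeasure P]

lemma Q_le_one (net : BatchNetwork J P) (j : Fin J) (t : ℝ≥0) : net.Q j t ≤ 1 := by
  have := net.customerGen_nonneg (z := fun _ => 0) (fun _ => le_rfl) j t
  simpa [customerGen, Q] using this

lemma ofReal_one_sub_ageGen (net : BatchNetwork J P) {z : Fin J → ℝ} (hz0 : ∀ k, 0 ≤ z k)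
    (hz1 : ∀ k, z k ≤ 1) {s : ℝ} (hs : 0 ≤ s) :
    ENNReal.ofReal (1 - net.ageGen z s)
      = ∫⁻ S, ENNReal.ofReal (1 - ∏ j, net.customerGen z j s.toNNReal ^ S j) ∂net.batchLaw := by
  have := net.isProbabilityMeasure_batchLaw
  have hint := net.integrable_prod_customerGen hz0 hz1 s.toNNReal
  rw [← ofReal_integral_eq_lintegral_ofReal (f := fun S : Fin J → ℕ =>
      1 - ∏ j, net.customerGen z j s.toNNReal ^ S j) ((integrable_const _).sub hint)
    (Eventually.of_forall fun S => sub_nonneg.2 (net.prod_customerGen_mem hz0 hz1 _ S).2),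
    integral_sub (integrable_const _) hint]
  simp [ageGen, hs, batchGen]

lemma measurable_logistic_totalBatch (c δ : ℝ) :
    Measurable fun p : ℝ × (Fin J → ℕ) => ENNReal.ofReal
      (c * (∑ j, (p.2 j : ℝ)) * Real.exp (-(δ * p.1)) /
        (1 + c * (∑ j, (p.2 j : ℝ)) * Real.exp (-(δ * p.1)))) := by
  have h : Measurable fun p : ℝ × (Fin J → ℕ) => ∑ j, (p.2 j : ℝ) :=
    (measurable_of_countable fun S : Fin J → ℕ => ∑ j, (S j : ℝ)).comp measurable_snd
  fun_prop

lemma lintegral_lintegral_logistic (net : BatchNetwork J P) {c δ : ℝ} (hc : 0 ≤ c) (hδ : 0 < δ)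
    (s₀ : ℝ) :
    ∫⁻ s in Set.Ioi s₀, ∫⁻ S, ENNReal.ofReal (c * (∑ j, (S j : ℝ)) * Real.exp (-(δ * s)) /
        (1 + c * (∑ j, (S j : ℝ)) * Real.exp (-(δ * s)))) ∂net.batchLaw
      = ∫⁻ S, ENNReal.ofReal (Real.log (1 + c * (∑ j, (S j : ℝ)) * Real.exp (-(δ * s₀))) / δ)
        ∂net.batchLaw := by
  have := net.isProbabilityMeasure_batchLaw
  rw [lintegral_lintegral_swap (measurable_logistic_totalBatch c δ).aemeasurable]
  exact lintegral_congr fun S => lintegral_logistic hδ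
    (mul_nonneg hc (Finset.sum_nonneg fun j _ => Nat.cast_nonneg _)) s₀

lemma lintegral_one_sub_ageGen_le (net : BatchNetwork J P) {C δ : ℝ} (hC : 0 ≤ C) (hδ : 0 < δ)
    (hQ : ∀ j (t : ℝ≥0), net.Q j t ≤ C * Real.exp (-(δ * t))) {z : Fin J → ℝ} {η : ℝ}
    (hη0 : 0 ≤ η) (hη1 : η ≤ 1) (hz : ∀ k, 1 - z k ≤ η) (hz1 : ∀ k, z k ≤ 1) :
    ∫⁻ s in Set.Ioi 0, ENNReal.ofReal (1 - net.ageGen z s)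
      ≤ ∫⁻ S, ENNReal.ofReal (2 / δ * Real.log (1 + η * C * ∑ j, (S j : ℝ))) ∂net.batchLaw := by
  have hz0 : ∀ k, 0 ≤ z k := fun k => by linarith [hz k]
  have hle : ∀ s ∈ Set.Ioi (0 : ℝ), ENNReal.ofReal (1 - net.ageGen z s)
      ≤ 2 * ∫⁻ S, ENNReal.ofReal (η * C * (∑ j, (S j : ℝ)) * Real.exp (-(δ * s)) /
        (1 + η * C * (∑ j, (S j : ℝ)) * Real.exp (-(δ * s)))) ∂net.batchLaw := by
    intro s hs
    have hs : 0 < s := hs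
    rw [net.ofReal_one_sub_ageGen hz0 hz1 hs.le, ← lintegral_const_mul _ (measurable_of_countable _)]
    refine lintegral_mono fun S => ?_
    set x : ℝ := η * C * (∑ j, (S j : ℝ)) * Real.exp (-(δ * s)) with hx
    have hx0 : 0 ≤ x := by positivity
    have hp := (net.prod_customerGen_mem hz0 hz1 s.toNNReal S).1
    have hlow := (prod_one_sub_pow_bounds (a := fun j => 1 - net.customerGen z j s.toNNReal)
      (fun j => by linarith [net.customerGen_le_one hz1 j s.toNNReal])
      (fun j => by linarith [net.customerGen_nonneg hz0 j s.toNNReal]) S).1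
    simp only [sub_sub_cancel] at hlow
    have hsum : ∑ j, S j * (1 - net.customerGen z j s.toNNReal) ≤ x := by
      rw [hx, Finset.mul_sum, Finset.sum_mul]
      refine Finset.sum_le_sum fun j _ => ?_
      have h1 : 1 - net.customerGen z j s.toNNReal ≤ η * net.Q j s.toNNReal := by
        simp only [customerGen, sub_sub_cancel, Q, Finset.mul_sum]
        refine Finset.sum_le_sum fun k _ => ?_
        rw [mul_comm]
        exact mul_le_mul_of_nonneg_right (hz k) (net.q_nonneg j k _)
      have h2 := hQ j s.toNNReal
      rw [Real.coe_toNNReal _ hs.le] at h2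
      calc (S j : ℝ) * (1 - net.customerGen z j s.toNNReal)
          ≤ S j * (η * (C * Real.exp (-(δ * s)))) := by
            gcongr
            exact h1.trans (by gcongr)
        _ = _ := by ring
    rw [← ENNReal.ofReal_ofNat 2, ← ENNReal.ofReal_mul (by norm_num)]
    exact ENNReal.ofReal_le_ofReal (min_one_le_two_mul_div hx0 (by linarith) (by linarith))
  have hηC : 0 ≤ η * C := by positivity
  calc _ ≤ ∫⁻ s in Set.Ioi 0, 2 * ∫⁻ S, ENNReal.ofReal
          (η * C * (∑ j, (S j : ℝ)) * Real.exp (-(δ * s)) /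
          (1 + η * C * (∑ j, (S j : ℝ)) * Real.exp (-(δ * s)))) ∂net.batchLaw :=
        setLIntegral_mono' measurableSet_Ioi hle
    _ = 2 * ∫⁻ S, ENNReal.ofReal (Real.log (1 + η * C * ∑ j, (S j : ℝ)) / δ) ∂net.batchLaw := by
        have := net.isProbabilityMeasure_batchLaw
        rw [lintegral_const_mul _ (measurable_logistic_totalBatch (η * C) δ).lintegral_prod_right',
          net.lintegral_lintegral_logistic hηC hδ]
        simp
    _ = _ := by
        rw [← lintegral_const_mul _ (measurable_of_countable _)]
        refine lintegral_congr fun S => ?_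
        rw [← ENNReal.ofReal_ofNat 2, ← ENNReal.ofReal_mul (by norm_num)]
        congr 1
        ring

lemma le_lintegral_one_sub_ageGen (net : BatchNetwork J P) {c Δ s₀ w : ℝ} (hc : 0 ≤ c)
    (hΔ : 0 < Δ) (hs₀ : 0 ≤ s₀)
    (hQ : ∀ j (t : ℝ≥0), s₀ ≤ t → c * Real.exp (-(Δ * t)) ≤ net.Q j t)
    (hw0 : 0 ≤ w) (hw1 : w ≤ 1) :
    ∫⁻ S, ENNReal.ofReal (Real.log (1 + (1 - w) * c * (∑ j, (S j : ℝ)) * Real.exp (-(Δ * s₀))) / Δ)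
        ∂net.batchLaw
      ≤ ∫⁻ s in Set.Ioi 0, ENNReal.ofReal (1 - net.ageGen (fun _ => w) s) := by
  have hc' : 0 ≤ (1 - w) * c := mul_nonneg (by linarith) hc
  rw [← net.lintegral_lintegral_logistic hc' hΔ]
  refine le_trans (setLIntegral_mono' measurableSet_Ioi fun s hs => ?_)
    (lintegral_mono_set (Set.Ioi_subset_Ioi hs₀))
  have hs : s₀ < s := hs
  rw [net.ofReal_one_sub_ageGen (fun _ => hw0) (fun _ => hw1) (hs₀.trans hs.le)]
  refine lintegral_mono fun S => ENNReal.ofReal_le_ofReal ?_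
  set x : ℝ := (1 - w) * c * (∑ j, (S j : ℝ)) * Real.exp (-(Δ * s)) with hx
  have hx0 : 0 ≤ x := by positivity
  have hgen : ∀ j, 1 - net.customerGen (fun _ => w) j s.toNNReal = net.Q j s.toNNReal * (1 - w) := by
    intro j
    simp only [customerGen, sub_sub_cancel, Q, Finset.sum_mul]
  have hup := (prod_one_sub_pow_bounds
    (a := fun j => 1 - net.customerGen (fun _ => w) j s.toNNReal)
    (fun j => by linarith [net.customerGen_le_one (z := fun _ => w) (fun _ => hw1) j s.toNNReal])
    (fun j => by linarith [net.customerGen_nonneg (z := fun _ => w) (fun _ => hw0) j s.toNNReal])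
    S).2
  simp only [sub_sub_cancel] at hup
  have hsum : x ≤ ∑ j, S j * (1 - net.customerGen (fun _ => w) j s.toNNReal) := by
    rw [hx, Finset.mul_sum, Finset.sum_mul]
    refine Finset.sum_le_sum fun j _ => ?_
    have h2 := hQ j s.toNNReal (by rw [Real.coe_toNNReal _ (hs₀.trans hs.le)]; exact hs.le)
    rw [Real.coe_toNNReal _ (hs₀.trans hs.le)] at h2
    rw [hgen]
    calc _ = (S j : ℝ) * (c * Real.exp (-(Δ * s)) * (1 - w)) := by ring
      _ ≤ _ := by
        gcongr
  have h3 := hup.trans (inv_anti₀ (by linarith) (add_le_add_right hsum 1))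
  have h4 : x / (1 + x) = 1 - (1 + x)⁻¹ := by
    field_simp
    ring
  linarith

end BatchNetwork

namespace BatchNetwork

variable {J : ℕ} {Ω : Type*} [MeasurableSpace Ω] {P : Measure Ω}

lemma exists_forall_le_Q (net : BatchNetwork J P)
    (hQ : ∀ j, ∃ δ : ℝ, 0 < δ ∧
      (fun τ : ℝ≥0 => net.Q j τ) =Θ[atTop] fun τ : ℝ≥0 => Real.exp (-(δ * τ))) :
    ∃ c Δ s₀ : ℝ, 0 < c ∧ 0 < Δ ∧ 0 ≤ s₀ ∧
      ∀ j (t : ℝ≥0), s₀ ≤ t → c * Real.exp (-(Δ * t)) ≤ net.Q j t := by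
  have hj : ∀ j, ∃ (c δ : ℝ) (s : ℝ≥0), 0 < c ∧ 0 < δ ∧
      ∀ t : ℝ≥0, s ≤ t → Real.exp (-(δ * t)) ≤ c * net.Q j t := by
    intro j
    obtain ⟨δ, hδ, hΘ⟩ := hQ j
    obtain ⟨c, hc, hb⟩ := hΘ.2.exists_pos
    obtain ⟨s, hs⟩ := eventually_atTop.1 hb.bound
    refine ⟨c, δ, s, hc, hδ, fun t ht => ?_⟩
    have h1 := hs t ht
    rwa [Real.norm_of_nonneg (net.Q_nonneg j t), Real.norm_of_nonneg (Real.exp_pos _).le] at h1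
  choose c δ s hc hδ h using hj
  have hcs : 0 < 1 + ∑ j, c j :=
    add_pos_of_pos_of_nonneg one_pos (Finset.sum_nonneg fun j _ => (hc j).le)
  refine ⟨(1 + ∑ j, c j)⁻¹, 1 + ∑ j, δ j, (∑ j, s j : ℝ≥0), inv_pos.2 hcs,
    add_pos_of_pos_of_nonneg one_pos (Finset.sum_nonneg fun j _ => (hδ j).le), NNReal.coe_nonneg _,
    fun j t ht => ?_⟩
  have ht' : s j ≤ t := le_trans (Finset.single_le_sum (fun _ _ => zero_le) (Finset.mem_univ j))
    (NNReal.coe_le_coe.1 ht)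
  have h1 : c j ≤ ∑ j, c j := Finset.single_le_sum (fun j _ => (hc j).le) (Finset.mem_univ j)
  have h2 : δ j ≤ ∑ j, δ j := Finset.single_le_sum (fun j _ => (hδ j).le) (Finset.mem_univ j)
  rw [inv_mul_le_iff₀ hcs]
  calc Real.exp (-((1 + ∑ j, δ j) * t)) ≤ Real.exp (-(δ j * t)) := by
        gcongr
        linarith
    _ ≤ c j * net.Q j t := h j t ht'
    _ ≤ _ := by
        have := net.Q_nonneg j t
        gcongr
        linarith

lemma measure_N_eq (net : BatchNetwork J P) (t : ℝ≥0) (n : Fin J → ℕ) :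
    P {ω | ∀ k, net.N k t ω = n k} = P.map (net.natN t) {n} := by
  rw [Measure.map_apply_of_aemeasurable (net.aemeasurable_natN t) (measurableSet_singleton n)]
  refine measure_congr ?_
  filter_upwards [net.ae_N_eq_natN t] with ω h
  refine propext ?_
  change (∀ k, net.N k t ω = n k) ↔ net.natN t ω = n
  simp only [h, Nat.cast_inj, funext_iff]

variable [IsProbabilityMeasure P]

lemma exists_forall_Q_le (net : BatchNetwork J P)
    (hQ : ∀ j, ∃ δ : ℝ, 0 < δ ∧
      (fun τ : ℝ≥0 => net.Q j τ) =Θ[atTop] fun τ : ℝ≥0 => Real.exp (-(δ * τ))) :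
    ∃ C δ : ℝ, 0 ≤ C ∧ 0 < δ ∧ ∀ j (t : ℝ≥0), net.Q j t ≤ C * Real.exp (-(δ * t)) := by
  have hj : ∀ j, ∃ C δ : ℝ, 0 ≤ C ∧ 0 < δ ∧ ∀ t : ℝ≥0, net.Q j t ≤ C * Real.exp (-(δ * t)) := by
    intro j
    obtain ⟨δ, hδ, hΘ⟩ := hQ j
    obtain ⟨C, hC⟩ := hΘ.1.bound
    obtain ⟨s, hs⟩ := eventually_atTop.1 hC
    refine ⟨max C (Real.exp (δ * s)), δ, le_max_of_le_right (Real.exp_pos _).le, hδ, fun t => ?_⟩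
    rcases le_total s t with h | h
    · have h1 := hs t h
      rw [Real.norm_of_nonneg (net.Q_nonneg j t), Real.norm_of_nonneg (Real.exp_pos _).le] at h1
      exact h1.trans (by gcongr; exact le_max_left _ _)
    · calc net.Q j t ≤ 1 := net.Q_le_one j t
        _ ≤ Real.exp (δ * s) * Real.exp (-(δ * t)) := by
          rw [← Real.exp_add]
          refine Real.one_le_exp ?_
          have : (t : ℝ) ≤ s := h
          nlinarith
        _ ≤ _ := by gcongr; exact le_max_right _ _
  choose C δ hC hδ h using hj
  have hpos : 0 < 1 + ∑ j, (δ j)⁻¹ :=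
    add_pos_of_pos_of_nonneg one_pos (Finset.sum_nonneg fun j _ => (inv_pos.2 (hδ j)).le)
  refine ⟨∑ j, C j, (1 + ∑ j, (δ j)⁻¹)⁻¹, Finset.sum_nonneg fun j _ => hC j, inv_pos.2 hpos,
    fun j t => (h j t).trans ?_⟩
  have h1 : C j ≤ ∑ j, C j := Finset.single_le_sum (fun j _ => hC j) (Finset.mem_univ j)
  have h2 : (1 + ∑ j, (δ j)⁻¹)⁻¹ ≤ δ j := by
    refine inv_le_of_inv_le₀ (hδ j) ?_
    have := Finset.single_le_sum (f := fun j => (δ j)⁻¹) (fun j _ => (inv_pos.2 (hδ j)).le)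
      (Finset.mem_univ j)
    linarith
  have h3 : (0 : ℝ) ≤ ∑ j, C j := Finset.sum_nonneg fun j _ => hC j
  gcongr

lemma lintegral_map_natN (net : BatchNetwork J P) {z : Fin J → ℝ} (hz0 : ∀ k, 0 ≤ z k)
    (hz1 : ∀ k, z k ≤ 1) (t : ℝ≥0) :
    ∫⁻ S, ENNReal.ofReal (∏ k, z k ^ S k) ∂P.map (net.natN t)
      = ENNReal.ofReal (poissonFunctional net.rate (net.ageGen z) t) := by
  rw [lintegral_map' (measurable_of_countable _).aemeasurable (net.aemeasurable_natN t),
    net.lintegral_prod_pow_natN hz0 hz1]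

/-- The network is ergodic if the generating functions of a batch satisfy an integrability condition
and their integrals vanish as the argument tends to `1`. -/
lemma isErgodic_of_lintegral (net : BatchNetwork J P)
    (hfin : ∀ z : Fin J → ℝ, (∀ k, 0 ≤ z k) → (∀ k, z k ≤ 1) →
      ∫⁻ s in Set.Ioi 0, ENNReal.ofReal (1 - net.ageGen z s) < ∞)
    (hlim : Tendsto (fun m : ℕ => ∫⁻ s in Set.Ioi 0,
      ENNReal.ofReal (1 - net.ageGen (fun _ => 1 - 1 / ((m : ℝ) + 1)) s)) atTop (𝓝 0)) :
    net.IsErgodic := by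
  have hprob : ∀ t, IsProbabilityMeasure (P.map (net.natN t)) := fun t =>
    Measure.isProbabilityMeasure_map (net.aemeasurable_natN t)
  let I : (Fin J → ℝ) → ℝ := fun z => ∫ s in Set.Ioi 0, (1 - net.ageGen z s)
  have hI : ∀ z : Fin J → ℝ, (∀ k, 0 ≤ z k) → (∀ k, z k ≤ 1) →
      I z = (∫⁻ s in Set.Ioi 0, ENNReal.ofReal (1 - net.ageGen z s)).toReal := fun z h0 h1 =>
    integral_eq_lintegral_of_nonneg_ae
      (Eventually.of_forall fun s => sub_nonneg.2 (net.ageGen_le_one h0 h1 s))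
      (measurable_const.sub (net.measurable_ageGen h0 h1)).aestronglyMeasurable
  have hconv : ∀ z : Fin J → ℝ, (∀ k, 0 ≤ z k) → (∀ k, z k ≤ 1) →
      Tendsto (fun t : ℝ≥0 => ∫⁻ S, ENNReal.ofReal (∏ k, z k ^ S k) ∂P.map (net.natN t)) atTop
        (𝓝 (ENNReal.ofReal (Real.exp (-(net.rate * I z))))) := by
    intro z h0 h1
    simp only [net.lintegral_map_natN h0 h1]
    have hint : IntegrableOn (fun s => 1 - net.ageGen z s) (Set.Ioi 0) := by
      refine ⟨(measurable_const.sub (net.measurable_ageGen h0 h1)).aestronglyMeasurable, ?_⟩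
      rw [hasFiniteIntegral_iff_ofReal
        (Eventually.of_forall fun s => sub_nonneg.2 (net.ageGen_le_one h0 h1 s))]
      exact hfin z h0 h1
    have h := intervalIntegral_tendsto_integral_Ioi 0 hint (NNReal.tendsto_coe_atTop.2 tendsto_id)
    exact ENNReal.tendsto_ofReal ((Real.continuous_exp.tendsto _).comp (h.const_mul net.rate).neg)
  have hone : Tendsto (fun m : ℕ => ENNReal.ofReal
      (Real.exp (-(net.rate * I fun _ => 1 - 1 / ((m : ℝ) + 1))))) atTop (𝓝 1) := by
    have h0 : ∀ m : ℕ, (0 : ℝ) ≤ 1 - 1 / ((m : ℝ) + 1) := fun m => by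
      rw [sub_nonneg, div_le_one (by positivity)]
      linarith [(Nat.cast_nonneg m : (0 : ℝ) ≤ m)]
    have h1 : ∀ m : ℕ, 1 - 1 / ((m : ℝ) + 1) ≤ 1 := fun m => by
      rw [sub_le_self_iff]
      positivity
    have h2 : Tendsto (fun m : ℕ => I fun _ => 1 - 1 / ((m : ℝ) + 1)) atTop (𝓝 0) := by
      refine ((ENNReal.tendsto_toReal ENNReal.zero_ne_top).comp hlim).congr fun m => ?_
      rw [hI _ (fun _ => h0 m) fun _ => h1 m]
      rfl
    have h3 := ENNReal.tendsto_ofReal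
      ((Real.continuous_exp.tendsto _).comp (h2.const_mul net.rate).neg)
    simpa using h3
  obtain ⟨π, hπ⟩ := exists_pmf_tendsto_of_tendsto_genFun _ _ hconv hone
  exact ⟨π, fun n => by simpa only [net.measure_N_eq] using hπ n⟩

lemma lintegral_one_sub_ageGen_lt_top_of_isErgodic (net : BatchNetwork J P) (h : net.IsErgodic)
    {w : ℝ} (hw0 : 0 < w) (hw1 : w ≤ 1) :
    ∫⁻ s in Set.Ioi 0, ENNReal.ofReal (1 - net.ageGen (fun _ => w) s) < ∞ := by
  obtain ⟨π, hπ⟩ := h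
  obtain ⟨n, hn⟩ : ∃ n, π n ≠ 0 := by
    obtain ⟨n, hn⟩ := π.support_nonempty
    exact ⟨n, (PMF.mem_support_iff _ _).1 hn⟩
  set g := net.ageGen fun _ => w with hg
  have hgm : Measurable g := net.measurable_ageGen (fun _ => hw0.le) fun _ => hw1
  have hg0 : ∀ s, 0 ≤ g s := net.ageGen_nonneg fun _ => hw0.le
  have hg1 : ∀ s, g s ≤ 1 := net.ageGen_le_one (fun _ => hw0.le) fun _ => hw1
  have hle : ∀ t : ℝ≥0, P {ω | ∀ k, net.N k t ω = n k} * ENNReal.ofReal (∏ k, w ^ n k)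
      ≤ ENNReal.ofReal (poissonFunctional net.rate g t) := by
    intro t
    rw [net.measure_N_eq, ← net.lintegral_map_natN (fun _ => hw0.le) (fun _ => hw1), mul_comm,
      ← setLIntegral_const, ← lintegral_indicator (measurableSet_singleton n)]
    refine lintegral_mono fun S => ?_
    by_cases hS : S = n
    · simp [hS]
    · rw [Set.indicator_of_notMem (by simpa using hS)]
      exact zero_le
  have hwpos : 0 < ENNReal.ofReal (∏ k, w ^ n k) :=
    ENNReal.ofReal_pos.2 (Finset.prod_pos fun k _ => pow_pos hw0 _)
  obtain ⟨e, he0, he⟩ := ENNReal.lt_iff_exists_nnreal_btwn.1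
    (ENNReal.mul_pos hn hwpos.ne')
  have hev : ∀ᶠ t : ℝ≥0 in atTop, (e : ℝ) ≤ poissonFunctional net.rate g t := by
    have hlim := ENNReal.Tendsto.mul_const (hπ n) (b := ENNReal.ofReal (∏ k, w ^ n k))
      (.inr ENNReal.ofReal_ne_top)
    filter_upwards [hlim.eventually (lt_mem_nhds he)] with t ht
    have := ht.le.trans (hle t)
    rwa [← ENNReal.ofReal_coe_nnreal, ENNReal.ofReal_le_ofReal_iff (by exact (Real.exp_pos _).le)] at this
  have hint : IntegrableOn (fun s => 1 - g s) (Set.Ioi 0) := by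
    refine integrableOn_Ioi_of_intervalIntegral_norm_bounded (l := atTop) (b := fun t : ℝ≥0 => (t : ℝ))
      (-Real.log e / net.rate) 0 (fun t => ?_) (NNReal.tendsto_coe_atTop.2 tendsto_id) ?_
    · exact (intervalIntegrable_iff_integrableOn_Ioc_of_le t.coe_nonneg).1
        (intervalIntegrable_one_sub hgm hg0 hg1 0 t)
    · filter_upwards [hev] with t ht
      have he0 : (0 : ℝ) < e := by exact_mod_cast he0
      have h1 := Real.log_le_log he0 ht
      rw [poissonFunctional, Real.log_exp] at h1
      simp only [Real.norm_of_nonneg (sub_nonneg.2 (hg1 _))]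
      rw [le_div_iff₀ net.rate_pos]
      linarith
  rw [← hasFiniteIntegral_iff_ofReal (Eventually.of_forall fun s => sub_nonneg.2 (hg1 s))]
  exact hint.2

end BatchNetwork

theorem corollary4p4 {J : ℕ} {Ω : Type*} [MeasurableSpace Ω] {P : Measure Ω}
    [IsProbabilityMeasure P] (net : BatchNetwork J P)
    (hQ : ∀ j, ∃ δ : ℝ, 0 < δ ∧
      (fun τ : ℝ≥0 => net.Q j τ) =Θ[atTop] fun τ : ℝ≥0 => Real.exp (-(δ * τ))) :
    net.IsErgodic ↔
      ∫⁻ S, ENNReal.ofReal (Real.log ((∑ j, (S j : ℝ)) + 1)) ∂net.batchLaw < ∞ := by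
  have := net.isProbabilityMeasure_batchLaw
  have hA : ∀ S : Fin J → ℕ, 0 ≤ ∑ j, (S j : ℝ) := fun S =>
    Finset.sum_nonneg fun j _ => Nat.cast_nonneg _
  have hform : ∫⁻ S, ENNReal.ofReal (Real.log ((∑ j, (S j : ℝ)) + 1)) ∂net.batchLaw
      = ∫⁻ S, ENNReal.ofReal (Real.log (1 + 1 * ∑ j, (S j : ℝ))) ∂net.batchLaw := by
    simp only [one_mul, add_comm]
  rw [hform]
  have hscale : ∀ (c : ℝ), 0 ≤ c → ∀ f : (Fin J → ℕ) → ℝ,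
      ∫⁻ S, ENNReal.ofReal (c * f S) ∂net.batchLaw
        = ENNReal.ofReal c * ∫⁻ S, ENNReal.ofReal (f S) ∂net.batchLaw := by
    intro c hc f
    rw [← lintegral_const_mul _ (measurable_of_countable _)]
    simp only [ENNReal.ofReal_mul hc]
  constructor
  · intro h
    obtain ⟨c, Δ, s₀, hc, hΔ, hs₀, hQl⟩ := net.exists_forall_le_Q hQ
    have h1 := (net.le_lintegral_one_sub_ageGen hc.le hΔ hs₀ hQl (w := 1 / 2) (by norm_num)
      (by norm_num)).trans_lt
      (net.lintegral_one_sub_ageGen_lt_top_of_isErgodic h (by norm_num) (by norm_num))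
    refine lintegral_log_one_add_mul_lt_top hA zero_le_one
      (b := (1 - 1 / 2) * c * Real.exp (-(Δ * s₀))) (by positivity) ?_
    have h2 : ∫⁻ S : Fin J → ℕ, ENNReal.ofReal (Δ⁻¹ *
        Real.log (1 + (1 - 1 / 2) * c * Real.exp (-(Δ * s₀)) * ∑ j, (S j : ℝ))) ∂net.batchLaw < ∞ := by
      refine (lintegral_congr fun S => ?_).trans_lt h1
      rw [mul_right_comm _ (Real.exp _), inv_mul_eq_div]
    rw [hscale _ (by positivity)] at h2
    exact ENNReal.lt_top_of_mul_ne_top_right h2.ne (by simpa using hΔ)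
  · intro h
    obtain ⟨C, δ, hC, hδ, hQu⟩ := net.exists_forall_Q_le hQ
    have hfin : ∫⁻ S, ENNReal.ofReal (2 / δ * Real.log (1 + C * ∑ j, (S j : ℝ))) ∂net.batchLaw
        < ∞ := by
      rw [hscale _ (by positivity)]
      exact ENNReal.mul_lt_top ENNReal.ofReal_lt_top
        (lintegral_log_one_add_mul_lt_top hA hC one_pos h)
    refine net.isErgodic_of_lintegral (fun z h0 h1 => ?_) ?_
    · refine (net.lintegral_one_sub_ageGen_le hC hδ hQu zero_le_one le_rfl
        (fun k => by linarith [h0 k]) h1).trans_lt ?_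
      simpa only [one_mul] using hfin
    · have hu0 : ∀ m : ℕ, (0 : ℝ) ≤ 1 / ((m : ℝ) + 1) := fun m => by positivity
      have hu1 : ∀ m : ℕ, 1 / ((m : ℝ) + 1) ≤ 1 := fun m => by
        rw [div_le_one (by positivity)]
        linarith [(Nat.cast_nonneg m : (0 : ℝ) ≤ m)]
      have hlim := tendsto_lintegral_log_one_add_mul (measurable_of_countable _) hA (by positivity)
        hC hfin.ne hu0 hu1 tendsto_one_div_add_atTop_nhds_zero_nat
      exact tendsto_of_tendsto_of_tendsto_of_le_of_le tendsto_const_nhds hlim (fun _ => zero_le)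
        fun m => net.lintegral_one_sub_ageGen_le hC hδ hQu (hu0 m) (hu1 m)
          (fun _ => (sub_sub_cancel _ _).le) fun _ => sub_le_self _ (hu0 m)
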